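/- A learner has to identify an unknown simple undirected graph $G$ on a known vertex set $V$ with $|V|=n$. It may ask edge-detecting queries: the answer to a query $Q\subseteq V$ tells whether some edge of $G$ has both endpoints in $Q$. The queries are asked in rounds; the queries of one round are asked in parallel and may depend only on the answers of the earlier rounds and on the learner's random coins. The learner knows $n$ but has no information on the number of edges. It is an $R$-round Las Vegas learner if, on every $G$, it never uses more than $R$ rounds and outputs $G$ with probability $1$. Let $\log$ be the logarithm to base $2$, $\log^{[0]}n=n$ and $\log^{[k]}n=\log\log^{[k-1]}n$ (read as $0$ where a logarithm is negative or undefined). **Theorem.** For every integer $k\ge 0$ there is a number $R$, depending only on $k$, such that for every integer $d\ge 0$ there is a constant $C$, depending only on $k$ and $d$, with the following property. For every $n$ there is an $R$-round Las Vegas randomized learner on $n$ vertices that does not know the number of edges and that satisfies, for every $m\ge 1$ and every graph $G$ with $n$ vertices and at most $m$ edges: the expected number of queries it asks is at most $$C\left(m\log n+\sqrt m\,\bigl(\log^{[k]}n\bigr)\log n\right),$$ and the probability that it asks more than this number of queries is at most $1/n^{d}$. -/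

import Mathlib

open scoped ENNReal

/-- The answer of the oracle of the graph `G` to the edge-detecting query `Q`:
`true` iff `Q` contains both endpoints of some edge of `G`. -/
noncomputable def edgeOracle {n : ℕ} (G : SimpleGraph (Fin n)) (Q : Finset (Fin n)) : Bool :=
  open Classical in decide (∃ u ∈ Q, ∃ v ∈ Q, G.Adj u v)

/-- Deterministic learners for graphs on the vertex set `Fin n` that proceed in rounds.
A learner either stops and outputs a graph, or performs a round: it asks `t` queries in
parallel and continues in a way that depends on the `t` answers. -/
inductive Learner (n : ℕ) : Type
  | output (H : SimpleGraph (Fin n)) : Learner n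
  | round (t : ℕ) (Q : Fin t → Finset (Fin n)) (next : (Fin t → Bool) → Learner n) : Learner n

namespace Learner

/-- The graph that the learner outputs when the target graph is `G`. -/
noncomputable def result {n : ℕ} (G : SimpleGraph (Fin n)) : Learner n → SimpleGraph (Fin n)
  | output H => H
  | round _ Q next => result G (next fun i => edgeOracle G (Q i))

/-- The number of rounds that the learner performs when the target graph is `G`. -/
noncomputable def numRounds {n : ℕ} (G : SimpleGraph (Fin n)) : Learner n → ℕ
  | output _ => 0
  | round _ Q next => 1 + numRounds G (next fun i => edgeOracle G (Q i))

/-- The total number of queries (with repetitions) that the learner asks when the target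
graph is `G`. -/
noncomputable def numQueries {n : ℕ} (G : SimpleGraph (Fin n)) : Learner n → ℕ
  | output _ => 0
  | round t Q next => t + numQueries G (next fun i => edgeOracle G (Q i))

end Learner

/-- A randomized learner: a probability distribution over deterministic learners
(all coins are tossed in advance). It is given `n` only. -/
abbrev RandomizedLearner (n : ℕ) : Type := PMF (Learner n)

namespace RandomizedLearner

/-- Las Vegas: for every target graph the output is correct with probability one. -/
def IsLasVegas {n : ℕ} (A : RandomizedLearner n) : Prop :=
  ∀ G : SimpleGraph (Fin n), ∀ a ∈ A.support, a.result G = G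

/-- For every target graph and every outcome of the coins there are at most `R` rounds. -/
def RoundsAtMost {n : ℕ} (A : RandomizedLearner n) (R : ℕ) : Prop :=
  ∀ G : SimpleGraph (Fin n), ∀ a ∈ A.support, a.numRounds G ≤ R

/-- The expected number of queries on the target graph `G`. -/
noncomputable def expectedQueries {n : ℕ} (A : RandomizedLearner n)
    (G : SimpleGraph (Fin n)) : ℝ≥0∞ :=
  ∑' a : Learner n, A a * (a.numQueries G : ℝ≥0∞)

/-- The probability that more than `b` queries are asked on the target graph `G`. -/
noncomputable def probMoreQueries {n : ℕ} (A : RandomizedLearner n)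
    (G : SimpleGraph (Fin n)) (b : ℝ) : ℝ≥0∞ :=
  A.toOuterMeasure {a : Learner n | b < (a.numQueries G : ℝ)}

end RandomizedLearner

/-- The `k`-times iterated binary logarithm of `n`, with `iterLog 0 n = n`; it is cut off at `0`
where a logarithm becomes negative or undefined. -/
noncomputable def iterLog (k n : ℕ) : ℝ :=
  (fun x : ℝ => max 0 (Real.logb 2 x))^[k] (n : ℝ)

/-- The quantity `m log n + √m (log^[k] n) log n`. -/
noncomputable def queryBound (k n m : ℕ) : ℝ :=
  (m : ℝ) * Real.logb 2 n + Real.sqrt m * iterLog k n * Real.logb 2 n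

/-! Let a random set of scale `i` contain every vertex independently with probability `2⁻ⁱ`. By a
union bound such a set is dependent with probability at most `4⁻ⁱ ∑ deg`. So the least scale at
which most samples are answered "no", the base scale, satisfies `4 ^ base = O(m)`: it replaces the
unknown number of edges.

Call a vertex heavy if, at the base scale, adding it to a sample tends to destroy independence. A
second-moment argument (`mul_card_le_one`) shows that there are at most `2 ^ base = O(√m)` heavy
vertices, hence only `O(m)` pairs of them. For non-adjacent `u`, `v`, Harris' inequality
(`indProb_mul_le`) bounds the probability that a sample stays independent with both added from below
by the product of the single probabilities. Therefore `O(4 ^ base log n)` samples separate all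
non-adjacent pairs without a heavy vertex. For a heavy `v` one takes a finer scale with `2 ^ i = O(2
^ base + deg v)`, adds `v` to every sample and separates it from the non-heavy non-neighbours;
summed over heavy `v` this costs `O(m log n)`. What is left unseparated is edges and heavy pairs,
`O(m)` in number, and these are asked one by one. That last round also makes the output correct for
all coins.

A scale is found in `k + 1` rounds by testing all scales below rapidly growing bounds `b 1, b 2,
...` with `b (r + 1) ≤ 2 ^ b r`. If nothing below `b r` was accepted, then `2 ^ b r` is already
bounded in terms of the degrees, so the next stage is paid for by the edges
(`card_searchQueries_le_of_search`). Only the first stage, of size `b 1`, is not; running it for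
`O(√m)` heavy vertices gives the term `√m log^[k] n log n`.

Adaptivity causes no dependence problem. All samples are drawn in advance, and `GoodCoins` requires
every test that could ever be made to be reliable with respect to the set of all independent sets. A
Chernoff and union bound shows that it fails with polynomially small probability; the polynomial
worst-case cost is then negligible in expectation. -/

namespace EdgeLearning

open Finset

/-! ### Random subsets of a finite set and Harris' inequality -/

/-- The expectation of `h A`, where `A` is the random subset of `s` that contains every element
with probability `p`, independently. -/
noncomputable def subsetExp {V : Type*} (p : ℝ) (s : Finset V) (h : Finset V → ℝ) : ℝ :=
  ∑ A ∈ s.powerset, p ^ #A * (1 - p) ^ (#s - #A) * h A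

section subsetExp

variable {V : Type*} [DecidableEq V] {p q : ℝ} {s : Finset V} {h h' : Finset V → ℝ} {a b : V}

theorem subsetExp_insert (ha : a ∉ s) (h : Finset V → ℝ) :
    subsetExp p (insert a s) h =
      p * subsetExp p s (fun A => h (insert a A)) + (1 - p) * subsetExp p s h := by
  unfold subsetExp
  rw [sum_powerset_insert ha, mul_sum, mul_sum, add_comm]
  congr 1
  · refine sum_congr rfl fun A hA => ?_
    have hA' := mem_powerset.1 hA
    rw [card_insert_of_notMem fun h => ha (hA' h), card_insert_of_notMem ha, Nat.add_sub_add_right]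
    ring
  · refine sum_congr rfl fun A hA => ?_
    have hA' := card_le_card (mem_powerset.1 hA)
    rw [card_insert_of_notMem ha, Nat.sub_add_comm hA']
    ring

theorem subsetExp_one : subsetExp p s (fun _ => 1) = 1 := by
  induction s using Finset.induction_on with
  | empty => simp [subsetExp]
  | insert a s ha ih => rw [subsetExp_insert ha, ih]; ring

omit [DecidableEq V] in
theorem subsetExp_add :
    subsetExp p s (fun A => h A + h' A) = subsetExp p s h + subsetExp p s h' := by
  simp [subsetExp, mul_add, sum_add_distrib]

omit [DecidableEq V] in
theorem subsetExp_sub :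
    subsetExp p s (fun A => h A - h' A) = subsetExp p s h - subsetExp p s h' := by
  simp [subsetExp, mul_sub, sum_sub_distrib]

omit [DecidableEq V] in
theorem subsetExp_mul (c : ℝ) : subsetExp p s (fun A => c * h A) = c * subsetExp p s h := by
  simp only [subsetExp, mul_sum]
  exact sum_congr rfl fun A _ => by ring

omit [DecidableEq V] in
theorem subsetExp_sum {ι : Type*} (t : Finset ι) (f : ι → Finset V → ℝ) :
    subsetExp p s (fun A => ∑ i ∈ t, f i A) = ∑ i ∈ t, subsetExp p s (f i) := by
  simp only [subsetExp, mul_sum]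
  exact sum_comm

omit [DecidableEq V] in
theorem subsetExp_mono (hp : 0 ≤ p) (hp' : p ≤ 1) (hh : ∀ A, h A ≤ h' A) :
    subsetExp p s h ≤ subsetExp p s h' :=
  sum_le_sum fun A _ => mul_le_mul_of_nonneg_left (hh A) <|
    mul_nonneg (pow_nonneg hp _) (pow_nonneg (by linarith) _)

theorem subsetExp_mem (ha : a ∈ s) (h : Finset V → ℝ) :
    subsetExp p s (fun A => if a ∈ A then h A else 0) =
      p * subsetExp p s (fun A => h (insert a A)) := by
  obtain ⟨t, hat, rfl⟩ : ∃ t, a ∉ t ∧ insert a t = s :=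
    ⟨s.erase a, notMem_erase a s, insert_erase ha⟩
  rw [subsetExp_insert hat, subsetExp_insert hat]
  have : subsetExp p t (fun A => if a ∈ A then h A else 0) = 0 :=
    sum_eq_zero fun A hA => by
      have : a ∉ A := fun h => hat (mem_powerset.1 hA h)
      simp [this]
  rw [this]
  simp only [mem_insert, true_or, if_true, insert_idem]
  ring

theorem subsetExp_mem_mem (ha : a ∈ s) (hb : b ∈ s) (hab : a ≠ b) (h : Finset V → ℝ) :
    subsetExp p s (fun A => if a ∈ A ∧ b ∈ A then h A else 0) =
      p ^ 2 * subsetExp p s (fun A => h (insert a (insert b A))) := by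
  simp only [ite_and]
  rw [subsetExp_mem ha]
  simp only [mem_insert, hab.symm, false_or]
  rw [subsetExp_mem hb]
  ring

/-- Element by element: a larger density moves weight from `h A` to the smaller value `h (insert a
A)`. -/
theorem subsetExp_antitone_density (hq : 0 ≤ q) (hqp : q ≤ p) (hp : p ≤ 1) (hh : Antitone h) :
    subsetExp p s h ≤ subsetExp q s h := by
  induction s using Finset.induction_on generalizing h with
  | empty => simp [subsetExp]
  | insert a s ha ih =>
    rw [subsetExp_insert ha, subsetExp_insert ha]
    have h1 := ih (h := fun A => h (insert a A)) fun A B hAB => hh (insert_subset_insert a hAB)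
    have h2 := ih hh
    have h3 : subsetExp p s (fun A => h (insert a A)) ≤ subsetExp p s h :=
      subsetExp_mono (hq.trans hqp) hp fun A => hh (subset_insert a A)
    nlinarith [mul_le_mul_of_nonneg_left h1 hq,
      mul_le_mul_of_nonneg_left h2 (by linarith : 0 ≤ 1 - q),
      mul_le_mul_of_nonneg_left h3 (by linarith : 0 ≤ p - q)]

/-- Harris' inequality for two antitone functions of a random subset. -/
theorem subsetExp_mul_le (hp : 0 ≤ p) (hp' : p ≤ 1) (hh : Antitone h) (hh' : Antitone h') :
    subsetExp p s h * subsetExp p s h' ≤ subsetExp p s (fun A => h A * h' A) := by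
  induction s using Finset.induction_on generalizing h h' with
  | empty => simp [subsetExp]
  | insert a s ha ih =>
    rw [subsetExp_insert ha, subsetExp_insert ha, subsetExp_insert ha]
    have anti : ∀ {f : Finset V → ℝ}, Antitone f → Antitone fun A => f (insert a A) :=
      fun hf A B hAB => hf (insert_subset_insert a hAB)
    have le : ∀ {f : Finset V → ℝ}, Antitone f →
        0 ≤ subsetExp p s f - subsetExp p s (fun A => f (insert a A)) :=
      fun hf => sub_nonneg.2 <| subsetExp_mono hp hp' fun A => hf (subset_insert a A)
    have h1 := mul_le_mul_of_nonneg_left (ih (anti hh) (anti hh')) hp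
    have h2 := mul_le_mul_of_nonneg_left (ih hh hh') (by linarith : 0 ≤ 1 - p)
    -- Conditioning on the coin of `a` splits the covariance into the two conditional ones (`h1`,
    -- `h2`) and `p (1 - p)` times the product of the two drops caused by `a`, which have the same
    -- sign.
    have h3 := mul_nonneg (mul_nonneg hp (by linarith : 0 ≤ 1 - p)) (mul_nonneg (le hh) (le hh'))
    nlinarith [h1, h2, h3]

end subsetExp

/-! ### Finite product measures and Chernoff bounds -/

section ProductSpace

variable {ι α : Type*} [Fintype ι] [DecidableEq ι] [Fintype α] {w : ι → α → ℝ}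

/-- The expectation of `f` when the coordinates `x i` are independent and distributed according
to the weights `w i`. -/
noncomputable def piExp (w : ι → α → ℝ) (f : (ι → α) → ℝ) : ℝ :=
  ∑ x : ι → α, (∏ i, w i (x i)) * f x

theorem piExp_mono (hw : ∀ i a, 0 ≤ w i a) {f g : (ι → α) → ℝ} (hfg : ∀ x, f x ≤ g x) :
    piExp w f ≤ piExp w g :=
  sum_le_sum fun x _ => mul_le_mul_of_nonneg_left (hfg x) <| prod_nonneg fun i _ => hw i (x i)

theorem piExp_const_mul (c : ℝ) (f : (ι → α) → ℝ) :
    piExp w (fun x => c * f x) = c * piExp w f := by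
  simp only [piExp, mul_sum]
  exact sum_congr rfl fun x _ => by ring

theorem piExp_add (f g : (ι → α) → ℝ) :
    piExp w (fun x => f x + g x) = piExp w f + piExp w g := by
  simp [piExp, mul_add, sum_add_distrib]

theorem piExp_sum {κ : Type*} (t : Finset κ) (f : κ → (ι → α) → ℝ) :
    piExp w (fun x => ∑ i ∈ t, f i x) = ∑ i ∈ t, piExp w (f i) := by
  simp only [piExp, mul_sum]
  exact sum_comm

theorem piExp_prod (hw : ∀ i, ∑ a, w i a = 1) (J : Finset ι) (h : ι → α → ℝ) :
    piExp w (fun x => ∏ i ∈ J, h i (x i)) = ∏ i ∈ J, ∑ a, w i a * h i a := by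
  classical
  have key := Finset.prod_univ_sum (fun _ : ι => (univ : Finset α))
    (fun i a => w i a * if i ∈ J then h i a else 1)
  rw [Fintype.piFinset_univ] at key
  have e1 : ∀ x : ι → α, ∏ i, (w i (x i) * if i ∈ J then h i (x i) else 1) =
      (∏ i, w i (x i)) * ∏ i ∈ J, h i (x i) := fun x => by
    rw [prod_mul_distrib, prod_ite_mem, univ_inter]
  simp only [e1] at key
  rw [piExp, ← key]
  have e2 : ∀ i, (∑ a, w i a * if i ∈ J then h i a else 1) =
      if i ∈ J then ∑ a, w i a * h i a else 1 := fun i => by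
    split_ifs
    · rfl
    · simp [hw]
  simp only [e2]
  rw [prod_ite_mem, univ_inter]

theorem piExp_one (hw : ∀ i, ∑ a, w i a = 1) : piExp w (fun _ => 1) = 1 := by
  simpa using piExp_prod hw ∅ fun _ _ => 1

open Classical in
/-- The probability of `S` when the coordinates are independent with weights `w`. -/
noncomputable def piProb (w : ι → α → ℝ) (S : (ι → α) → Prop) : ℝ :=
  piExp w fun x => if S x then 1 else 0

theorem piProb_mono (hw : ∀ i a, 0 ≤ w i a) {S S' : (ι → α) → Prop} (h : ∀ x, S x → S' x) :
    piProb w S ≤ piProb w S' :=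
  piExp_mono hw fun x => by
    by_cases hx : S x
    · simp [hx, h x hx]
    · simp only [hx, if_false]; split_ifs <;> norm_num

theorem piProb_false : piProb w (fun _ => False) = 0 := by simp [piProb, piExp]

theorem piProb_or_le (hw : ∀ i a, 0 ≤ w i a) (S S' : (ι → α) → Prop) :
    piProb w (fun x => S x ∨ S' x) ≤ piProb w S + piProb w S' := by
  rw [piProb, piProb, piProb, ← piExp_add]
  refine piExp_mono hw fun x => ?_
  by_cases h : S x <;> by_cases h' : S' x <;> simp [h, h']

theorem piProb_exists_le (hw : ∀ i a, 0 ≤ w i a) {κ : Type*} (t : Finset κ)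
    (S : κ → (ι → α) → Prop) :
    piProb w (fun x => ∃ j ∈ t, S j x) ≤ ∑ j ∈ t, piProb w (S j) := by
  simp only [piProb]
  rw [← piExp_sum]
  refine piExp_mono hw fun x => ?_
  split_ifs with h
  · obtain ⟨j, hj, hS⟩ := h
    refine le_trans ?_ (single_le_sum (fun i _ => ?_) hj)
    · simp [hS]
    · split_ifs <;> norm_num
  · exact sum_nonneg fun i _ => by split_ifs <;> norm_num

theorem piProb_le_of_le (hw : ∀ i a, 0 ≤ w i a) {S : (ι → α) → Prop} {f : (ι → α) → ℝ} {c : ℝ}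
    (hf : ∀ x, 0 ≤ f x) (hc : ∀ x, S x → 1 ≤ c * f x) (hc0 : 0 ≤ c) :
    piProb w S ≤ c * piExp w f := by
  rw [← piExp_const_mul]
  refine piExp_mono hw fun x => ?_
  split_ifs with h
  · exact hc x h
  · exact mul_nonneg hc0 (hf x)

/-- `q` is the probability of `P` under the weights `w`. -/
noncomputable def wtProb (w : α → ℝ) (P : α → Prop) : ℝ :=
  open Classical in ∑ a, w a * if P a then 1 else 0

theorem sum_ite_eq_wtProb {w : α → ℝ} (hw : ∑ a, w a = 1) (P : α → Prop) [DecidablePred P]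
    (c : ℝ) : (∑ a, w a * if P a then c else 1) = 1 + (c - 1) * wtProb w P := by
  calc (∑ a, w a * if P a then c else 1)
      = ∑ a, (w a + (c - 1) * (w a * if P a then 1 else 0)) :=
        sum_congr rfl fun a _ => by by_cases h : P a <;> simp [h]; ring
    _ = 1 + (c - 1) * wtProb w P := by
        rw [sum_add_distrib, hw, wtProb, mul_sum]
        exact congrArg _ (sum_congr rfl fun a _ => by by_cases h : P a <;> simp [h])

variable (hw0 : ∀ i a, 0 ≤ w i a) (hw1 : ∀ i, ∑ a, w i a = 1)

section Chernoff

omit [Fintype ι] [DecidableEq ι] [Fintype α] in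
open Classical in
theorem prod_ite_eq_pow (J : Finset ι) (P : α → Prop) (c : ℝ) (x : ι → α) :
    (∏ i ∈ J, if P (x i) then c else 1) = c ^ #{i ∈ J | P (x i)} := by
  rw [prod_ite]; simp

theorem two_pow_exp_log (k : ℕ) : (2 : ℝ) ^ k = Real.exp (k * Real.log 2) := by
  rw [Real.exp_nat_mul, Real.exp_log two_pos]

-- Markov's inequality for `2 ^ count`: every factor has mean at most `1 + δ / 2 ≤ exp (δ / 2)`, and
-- `log 2 - 1 / 2 > 1 / 8`.
open Classical in
include hw0 hw1 in
theorem chernoff_ge {J : Finset ι} {P : α → Prop} {δ : ℝ} (hδ : 0 ≤ δ)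
    (hq : ∀ i ∈ J, wtProb (w i) P ≤ δ / 2) :
    piProb w (fun x => δ * #J ≤ #{i ∈ J | P (x i)}) ≤ Real.exp (-(δ * #J / 8)) := by
  have h2 := Real.log_two_gt_d9
  have hb := piProb_le_of_le (S := fun x => δ * #J ≤ #{i ∈ J | P (x i)})
    (f := fun x => ∏ i ∈ J, if P (x i) then (2 : ℝ) else 1)
    (c := Real.exp (-(δ * #J * Real.log 2))) hw0
    (fun x => prod_nonneg fun i _ => by split_ifs <;> norm_num)
    (fun x hx => by
      rw [prod_ite_eq_pow, two_pow_exp_log, ← Real.exp_add]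
      apply Real.one_le_exp
      nlinarith [hx, h2]) (Real.exp_pos _).le
  refine hb.trans ?_
  rw [piExp_prod hw1 J fun _ a => if P a then (2 : ℝ) else 1]
  have : ∏ i ∈ J, (∑ a, w i a * if P a then (2 : ℝ) else 1) ≤ ∏ i ∈ J, Real.exp (δ / 2) := by
    refine prod_le_prod (fun i _ => sum_nonneg fun a _ => mul_nonneg (hw0 i a) (by
      split_ifs <;> norm_num)) fun i hi => ?_
    rw [sum_ite_eq_wtProb (hw1 i)]
    linarith [Real.add_one_le_exp (δ / 2), hq i hi]
  rw [prod_const, ← Real.exp_nat_mul] at this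
  refine (mul_le_mul_of_nonneg_left this (Real.exp_pos _).le).trans ?_
  rw [← Real.exp_add, Real.exp_le_exp]
  have : 0 ≤ δ * #J := by positivity
  nlinarith

-- Markov's inequality for `2⁻¹ ^ count`: every factor has mean at most `1 - δ ≤ exp (-δ)`, and `1 -
-- log 2 > 1 / 8`.
open Classical in
include hw0 hw1 in
theorem chernoff_le {J : Finset ι} {P : α → Prop} {δ : ℝ} (hδ : 0 ≤ δ)
    (hq : ∀ i ∈ J, 2 * δ ≤ wtProb (w i) P) :
    piProb w (fun x => #{i ∈ J | P (x i)} ≤ δ * #J) ≤ Real.exp (-(δ * #J / 8)) := by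
  have h2 := Real.log_two_lt_d9
  have h2' := Real.log_two_gt_d9
  have hb := piProb_le_of_le (S := fun x => #{i ∈ J | P (x i)} ≤ δ * #J)
    (f := fun x => ∏ i ∈ J, if P (x i) then (2⁻¹ : ℝ) else 1)
    (c := Real.exp (δ * #J * Real.log 2)) hw0
    (fun x => prod_nonneg fun i _ => by split_ifs <;> norm_num)
    (fun x hx => by
      rw [prod_ite_eq_pow, inv_pow, two_pow_exp_log, ← Real.exp_neg, ← Real.exp_add]
      apply Real.one_le_exp
      nlinarith [hx, h2']) (Real.exp_pos _).le
  refine hb.trans ?_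
  rw [piExp_prod hw1 J fun _ a => if P a then (2⁻¹ : ℝ) else 1]
  have : ∏ i ∈ J, (∑ a, w i a * if P a then (2⁻¹ : ℝ) else 1) ≤ ∏ i ∈ J, Real.exp (-δ) := by
    refine prod_le_prod (fun i _ => sum_nonneg fun a _ => mul_nonneg (hw0 i a) (by
      split_ifs <;> norm_num)) fun i hi => ?_
    rw [sum_ite_eq_wtProb (hw1 i)]
    linarith [Real.add_one_le_exp (-δ), hq i hi]
  rw [prod_const, ← Real.exp_nat_mul] at this
  refine (mul_le_mul_of_nonneg_left this (Real.exp_pos _).le).trans ?_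
  rw [← Real.exp_add, Real.exp_le_exp]
  have : 0 ≤ δ * #J := by positivity
  nlinarith

include hw0 hw1 in
theorem piProb_forall_not_le {J : Finset ι} {P : α → Prop} {η : ℝ}
    (hq : ∀ i ∈ J, η ≤ wtProb (w i) P) :
    piProb w (fun x => ∀ i ∈ J, ¬ P (x i)) ≤ Real.exp (-(η * #J)) := by
  classical
  have hb := piProb_le_of_le (S := fun x => ∀ i ∈ J, ¬ P (x i))
    (f := fun x => ∏ i ∈ J, if P (x i) then (0 : ℝ) else 1) (c := 1) hw0
    (fun x => prod_nonneg fun i _ => by split_ifs <;> norm_num)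
    (fun x hx => by
      rw [prod_congr rfl fun i hi => if_neg (hx i hi)]; simp) zero_le_one
  refine hb.trans ?_
  rw [piExp_prod hw1 J fun _ a => if P a then (0 : ℝ) else 1, one_mul]
  have : ∏ i ∈ J, (∑ a, w i a * if P a then (0 : ℝ) else 1) ≤ ∏ i ∈ J, Real.exp (-η) := by
    refine prod_le_prod (fun i _ => sum_nonneg fun a _ => mul_nonneg (hw0 i a) (by
      split_ifs <;> norm_num)) fun i hi => ?_
    rw [sum_ite_eq_wtProb (hw1 i)]
    linarith [Real.add_one_le_exp (-η), hq i hi]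
  rw [prod_const, ← Real.exp_nat_mul] at this
  refine this.trans_eq ?_
  congr 1
  ring

end Chernoff

end ProductSpace

/-! ### Independence of a random vertex set -/

section GraphSamples

variable {n : ℕ} (G : SimpleGraph (Fin n))

/-- No edge of `G` has both endpoints in `Q`. -/
def Indep (Q : Finset (Fin n)) : Prop := ∀ u ∈ Q, ∀ v ∈ Q, ¬ G.Adj u v

variable {G}

theorem Indep.mono {Q Q' : Finset (Fin n)} (h : Indep G Q') (hQ : Q ⊆ Q') : Indep G Q :=
  fun u hu v hv => h u (hQ hu) v (hQ hv)

variable (G)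

open Classical in
/-- The indicator of the independence of `A ∪ X`. -/
noncomputable def indInd (X A : Finset (Fin n)) : ℝ := if Indep G (A ∪ X) then 1 else 0

/-- The probability that `A ∪ X` is independent, for a random set `A` of density `p`. -/
noncomputable def indProb (p : ℝ) (X : Finset (Fin n)) : ℝ := subsetExp p univ (indInd G X)

variable {G}

theorem antitone_indInd (X : Finset (Fin n)) : Antitone (indInd G X) := fun A B hAB => by
  unfold indInd
  by_cases h : Indep G (B ∪ X)
  · simp [h, h.mono (union_subset_union_left hAB)]
  · simp only [h, if_false]; split_ifs <;> norm_num

theorem indInd_nonneg (X A : Finset (Fin n)) : 0 ≤ indInd G X A := by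
  unfold indInd; split_ifs <;> norm_num

variable {p q : ℝ} (hp : 0 ≤ p) (hp1 : p ≤ 1)

theorem indProb_antitone {X : Finset (Fin n)} (hq : 0 ≤ q) (hqp : q ≤ p) (hp1 : p ≤ 1) :
    indProb G p X ≤ indProb G q X :=
  subsetExp_antitone_density hq hqp hp1 (antitone_indInd X)

include hp hp1

-- Union bound over ordered adjacent pairs, each contained in the sample with probability `p ^ 2`.
open Classical in
theorem one_sub_indProb_empty_le :
    1 - indProb G p ∅ ≤ p ^ 2 * ∑ u, (G.degree u : ℝ) := by
  calc 1 - indProb G p ∅ = subsetExp p univ (fun A => 1 - indInd G ∅ A) := by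
        rw [subsetExp_sub, subsetExp_one, indProb]
    _ ≤ subsetExp p univ
          (fun A => ∑ u, ∑ v ∈ G.neighborFinset u, if u ∈ A ∧ v ∈ A then (1 : ℝ) else 0) := by
        refine subsetExp_mono hp hp1 fun A => ?_
        have h0 : ∀ u, ∀ v, (0 : ℝ) ≤ if u ∈ A ∧ v ∈ A then (1 : ℝ) else 0 := fun u v => by
          split_ifs <;> norm_num
        unfold indInd
        split_ifs with h
        · simpa using sum_nonneg fun u _ => sum_nonneg fun v _ => h0 u v
        · simp only [Indep, union_empty] at h
          push Not at h
          obtain ⟨u, hu, v, hv, huv⟩ := h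
          have h1 := single_le_sum (f := fun u => ∑ v ∈ G.neighborFinset u,
            if u ∈ A ∧ v ∈ A then (1 : ℝ) else 0) (fun u _ => sum_nonneg fun v _ => h0 u v)
            (mem_univ u)
          have h2 := single_le_sum (f := fun v => if u ∈ A ∧ v ∈ A then (1 : ℝ) else 0)
            (fun v _ => h0 u v) ((G.mem_neighborFinset u v).2 huv)
          simp only [hu, hv, and_self, if_true] at h1 h2 ⊢
          linarith
    _ = p ^ 2 * ∑ u, (G.degree u : ℝ) := by
        rw [subsetExp_sum, mul_sum]
        refine sum_congr rfl fun u _ => ?_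
        rw [subsetExp_sum, ← SimpleGraph.card_neighborFinset_eq_degree]
        rw [sum_congr rfl fun v hv => subsetExp_mem_mem (mem_univ u) (mem_univ v)
          ((G.mem_neighborFinset u v).1 hv).ne fun _ => 1]
        simp [subsetExp_one]
        ring

-- If `A` is independent but `A ∪ {v}` is not, then `A` meets the neighbourhood of `v`.
open Classical in
theorem one_sub_indProb_singleton_le (v : Fin n) :
    1 - indProb G p {v} ≤ 1 - indProb G p ∅ + p * G.degree v := by
  calc 1 - indProb G p {v} = subsetExp p univ (fun A => 1 - indInd G {v} A) := by
        rw [subsetExp_sub, subsetExp_one, indProb]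
    _ ≤ subsetExp p univ (fun A => (1 - indInd G ∅ A) +
          ∑ u ∈ G.neighborFinset v, if u ∈ A then (1 : ℝ) else 0) := by
        refine subsetExp_mono hp hp1 fun A => ?_
        have h0 : ∀ u, (0 : ℝ) ≤ if u ∈ A then (1 : ℝ) else 0 := fun u => by
          split_ifs <;> norm_num
        have h1 : 0 ≤ ∑ u ∈ G.neighborFinset v, if u ∈ A then (1 : ℝ) else 0 :=
          sum_nonneg fun u _ => h0 u
        by_cases hA : Indep G A
        · by_cases hAv : Indep G (A ∪ {v})
          · simp only [indInd, hA, hAv, union_empty, if_true]; linarith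
          · obtain ⟨u, hu, huv⟩ : ∃ u ∈ A, G.Adj v u := by
              by_contra! hcon
              refine hAv fun x hx y hy hxy => ?_
              simp only [mem_union, mem_singleton] at hx hy
              rcases hx with hx | rfl <;> rcases hy with hy | rfl
              · exact hA x hx y hy hxy
              · exact hcon x hx hxy.symm
              · exact hcon y hy hxy
              · exact G.loopless.irrefl _ hxy
            have h2 := single_le_sum (f := fun u => if u ∈ A then (1 : ℝ) else 0)
              (fun u _ => h0 u) ((G.mem_neighborFinset v u).2 huv)
            simp only [hu, if_true] at h2
            simp only [indInd, hA, hAv, union_empty, if_true, if_false]; linarith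
        · have := indInd_nonneg (G := G) {v} A
          simp only [indInd, hA, union_empty, if_false] at this ⊢
          linarith
    _ = 1 - indProb G p ∅ + p * G.degree v := by
        rw [subsetExp_add, subsetExp_sub, subsetExp_one, indProb, subsetExp_sum,
          ← SimpleGraph.card_neighborFinset_eq_degree]
        rw [sum_congr rfl fun u _ => subsetExp_mem (mem_univ u) fun _ => 1]
        simp [subsetExp_one]
        ring

/-- For non-adjacent `u`, `v`, the set `A ∪ {u, v}` is independent as soon as `A ∪ {u}` and `A ∪
{v}` are. Both events are decreasing in `A`, so Harris' inequality applies. -/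
theorem indProb_mul_le {u v : Fin n} (huv : ¬ G.Adj u v) :
    indProb G p {u} * indProb G p {v} ≤ indProb G p {u, v} := by
  refine (subsetExp_mul_le hp hp1 (antitone_indInd _) (antitone_indInd _)).trans ?_
  refine subsetExp_mono hp hp1 fun A => ?_
  unfold indInd
  by_cases hu : Indep G (A ∪ {u}) <;> by_cases hv : Indep G (A ∪ {v})
  · have : Indep G (A ∪ {u, v}) := by
      intro x hx y hy hxy
      simp only [mem_union, mem_singleton, mem_insert] at hx hy
      have hu' := fun x hx y hy => hu x (by simpa using hx) y (by simpa using hy)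
      have hv' := fun x hx y hy => hv x (by simpa using hx) y (by simpa using hy)
      have huv' : ¬ G.Adj v u := fun h => huv h.symm
      rcases hx with hx | rfl | rfl <;> rcases hy with hy | rfl | rfl
      · exact hu' x (.inr hx) y (.inr hy) hxy
      · exact hu' x (.inr hx) y (.inl rfl) hxy
      · exact hv' x (.inr hx) y (.inl rfl) hxy
      · exact hu' x (.inl rfl) y (.inr hy) hxy
      · exact G.loopless.irrefl _ hxy
      · exact huv hxy
      · exact hv' x (.inl rfl) y (.inr hy) hxy
      · exact huv' hxy
      · exact G.loopless.irrefl _ hxy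
    rw [if_pos hu, if_pos hv, if_pos this, one_mul]
  all_goals simp only [hu, hv, if_true, if_false, mul_zero, zero_mul]; split_ifs <;> norm_num

/-- Vertices that are unlikely to extend a random set to an independent one are few. -/
theorem mul_card_le_one (H : Finset (Fin n)) (h0 : 1 - indProb G p ∅ ≤ 1 / 16)
    (hH : ∀ v ∈ H, indProb G p {v} ≤ 1 / 2) : p * #H ≤ 1 := by
  by_contra! hμ
  set μ := p * #H with hμd
  -- `Y` counts the sampled vertices of `H`, with mean `μ`. Independent samples contribute at most
  -- `μ / 2` to the mean, because vertices of `H` are unlikely to extend a sample. Dependent samples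
  -- are rare and contribute at most `3 / 8 * μ` by the second moment. The total falls short of `μ`.
  let Y : Finset (Fin n) → ℝ := fun A => ∑ v ∈ H, if v ∈ A then 1 else 0
  have hY : subsetExp p univ Y = μ := by
    rw [subsetExp_sum, sum_congr rfl fun v _ => subsetExp_mem (mem_univ v) fun _ => 1]
    simp [subsetExp_one, hμd, mul_comm]
  have hYY : subsetExp p univ (fun A => Y A * Y A) ≤ 2 * μ ^ 2 := by
    have e : ∀ A, Y A * Y A =
        ∑ u ∈ H, ∑ v ∈ H, if u ∈ A ∧ v ∈ A then (1 : ℝ) else 0 := fun A => by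
      simp only [Y, sum_mul_sum]
      refine sum_congr rfl fun u _ => sum_congr rfl fun v _ => ?_
      by_cases h : u ∈ A <;> by_cases h' : v ∈ A <;> simp [h, h']
    simp only [e]
    rw [subsetExp_sum]
    have : ∀ u ∈ H, subsetExp p univ
        (fun A => ∑ v ∈ H, if u ∈ A ∧ v ∈ A then (1 : ℝ) else 0) ≤ p * μ + p := by
      intro u hu
      rw [subsetExp_sum, ← add_sum_erase _ _ hu, sum_congr rfl fun v hv =>
        subsetExp_mem_mem (mem_univ u) (mem_univ v) (ne_of_mem_erase hv).symm fun _ => 1]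
      simp only [and_self]
      rw [subsetExp_mem (mem_univ u) fun _ => 1]
      simp only [subsetExp_one, mul_one, sum_const, nsmul_eq_mul]
      have : (#(H.erase u) : ℝ) ≤ #H := by exact_mod_cast card_le_card (erase_subset u H)
      nlinarith [mul_le_mul_of_nonneg_left this (sq_nonneg p)]
    refine (sum_le_sum this).trans ?_
    rw [sum_const, nsmul_eq_mul]
    nlinarith
  have hYg : subsetExp p univ (fun A => Y A * indInd G ∅ A) ≤ μ / 2 := by
    have e : ∀ A, Y A * indInd G ∅ A = ∑ v ∈ H, if v ∈ A then indInd G ∅ A else 0 := fun A => by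
      simp only [Y, sum_mul]
      refine sum_congr rfl fun u _ => ?_
      split_ifs <;> simp
    simp only [e]
    rw [subsetExp_sum, sum_congr rfl fun v _ => subsetExp_mem (mem_univ v) (indInd G ∅)]
    have : ∀ v ∈ H, p * subsetExp p univ (fun A => indInd G ∅ (insert v A)) ≤ p * (1 / 2) := by
      intro v hv
      refine mul_le_mul_of_nonneg_left ((le_of_eq ?_).trans (hH v hv)) hp
      unfold indProb
      congr 1
      ext A
      unfold indInd
      rw [union_empty, union_comm A, insert_eq]
    refine (sum_le_sum this).trans ?_
    rw [sum_const, nsmul_eq_mul]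
    linarith
  have hYb : subsetExp p univ (fun A => Y A * (1 - indInd G ∅ A)) ≤ 3 / 8 * μ := by
    have hpos : 0 < μ := by linarith
    -- On dependent samples use `y ≤ y ^ 2 / (16 * μ) + 4 * μ`; the two terms contribute at most `μ
    -- / 8` and `μ / 4`.
    calc subsetExp p univ (fun A => Y A * (1 - indInd G ∅ A))
        ≤ subsetExp p univ (fun A => 1 / (16 * μ) * (Y A * Y A) + 4 * μ * (1 - indInd G ∅ A)) := by
          refine subsetExp_mono hp hp1 fun A => ?_
          have h1 : indInd G ∅ A = 1 ∨ indInd G ∅ A = 0 := by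
            unfold indInd; split_ifs <;> simp
          rcases h1 with h1 | h1 <;> rw [h1]
          · have := mul_self_nonneg (Y A)
            simp only [sub_self, mul_zero, add_zero]
            positivity
          · rw [div_mul_eq_mul_div, one_mul, ← sub_nonneg]
            have : Y A * Y A / (16 * μ) + 4 * μ * (1 - 0) - Y A * (1 - 0) =
              (Y A - 8 * μ) ^ 2 / (16 * μ) := by
              field_simp
              ring
            rw [this]
            positivity
      _ ≤ 3 / 8 * μ := by
          rw [subsetExp_add, subsetExp_mul, subsetExp_mul, subsetExp_sub, subsetExp_one]
          have h1 : 1 / (16 * μ) * subsetExp p univ (fun A => Y A * Y A) ≤ μ / 8 := by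
            refine (mul_le_mul_of_nonneg_left hYY (by positivity)).trans (le_of_eq ?_)
            field_simp
            ring
          have h2 : 4 * μ * (1 - indProb G p ∅) ≤ 4 * μ * (1 / 16) :=
            mul_le_mul_of_nonneg_left h0 (by positivity)
          unfold indProb at h2
          linarith
  have hsum : subsetExp p univ Y = subsetExp p univ (fun A => Y A * indInd G ∅ A) +
      subsetExp p univ (fun A => Y A * (1 - indInd G ∅ A)) := by
    rw [← subsetExp_add]
    congr 1
    ext A
    ring
  linarith

omit hp hp1

/-- The weight of `A` as the random set of density `p`. -/
noncomputable def setWt (p : ℝ) (A : Finset (Fin n)) : ℝ := p ^ #A * (1 - p) ^ (n - #A)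

theorem setWt_nonneg (hp : 0 ≤ p) (hp1 : p ≤ 1) (A : Finset (Fin n)) : 0 ≤ setWt p A :=
  mul_nonneg (pow_nonneg hp _) (pow_nonneg (by linarith) _)

theorem sum_setWt_mul (h : Finset (Fin n) → ℝ) :
    ∑ A, setWt p A * h A = subsetExp p univ h := by
  simp [subsetExp, setWt]

theorem sum_setWt : ∑ A : Finset (Fin n), setWt p A = 1 := by
  have := sum_setWt_mul (n := n) (p := p) fun _ => 1
  simpa [subsetExp_one] using this

theorem wtProb_not_indep (X : Finset (Fin n)) :
    wtProb (setWt p) (fun A => ¬ Indep G (A ∪ X)) = 1 - indProb G p X := by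
  classical
  have e := subsetExp_sub (p := p) (s := univ) (h := fun _ => 1) (h' := indInd G X)
  rw [subsetExp_one] at e
  rw [wtProb, sum_setWt_mul, indProb, ← e]
  congr 1
  ext A
  unfold indInd
  by_cases h : Indep G (A ∪ X) <;> simp [h]

/-- Whether `A ∪ {v}` is independent does not depend on the coin of `v`. Hence the effect of adding
`v` can be read off from the plain samples that contain `v`. -/
theorem wtProb_mem_indep (v : Fin n) :
    wtProb (setWt p) (fun A => v ∈ A ∧ Indep G A) = p * indProb G p {v} := by
  classical
  have := subsetExp_mem (p := p) (mem_univ v) (indInd G ∅)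
  rw [wtProb, sum_setWt_mul, indProb]
  convert this using 2
  · ext A; by_cases h : v ∈ A <;> simp [h, indInd]
  · congr 1; ext A; rw [indInd, indInd, union_empty, insert_eq, union_comm]

theorem wtProb_mem_indep_insert (hp : 0 ≤ p) (hp1 : p ≤ 1) {u v : Fin n} (huv : ¬ G.Adj u v) :
    p * (indProb G p {u} * indProb G p {v}) ≤
      wtProb (setWt p) (fun A => u ∈ A ∧ Indep G (A ∪ {v})) := by
  classical
  refine (mul_le_mul_of_nonneg_left (indProb_mul_le hp hp1 huv) hp).trans (le_of_eq ?_)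
  have := subsetExp_mem (p := p) (mem_univ u) (indInd G {v})
  rw [wtProb, sum_setWt_mul, indProb]
  symm
  convert this using 2
  · ext A; by_cases h : u ∈ A <;> simp [h, indInd]
  · congr 1; ext A
    have : A ∪ {u, v} = insert u A ∪ {v} := by ext; simp
    simp [indInd, this]

theorem wtProb_mem_mem_indep (hp : 0 ≤ p) (hp1 : p ≤ 1) {u v : Fin n} (hne : u ≠ v)
    (huv : ¬ G.Adj u v) :
    p ^ 2 * (indProb G p {u} * indProb G p {v}) ≤
      wtProb (setWt p) (fun A => (u ∈ A ∧ v ∈ A) ∧ Indep G A) := by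
  classical
  refine (mul_le_mul_of_nonneg_left (indProb_mul_le hp hp1 huv) (sq_nonneg p)).trans (le_of_eq ?_)
  have := subsetExp_mem_mem (p := p) (mem_univ u) (mem_univ v) hne (indInd G ∅)
  rw [wtProb, sum_setWt_mul, indProb]
  symm
  convert this using 2
  · ext A; by_cases h : u ∈ A ∧ v ∈ A <;> simp [h, indInd]
  · congr 1; ext A
    have : A ∪ {u, v} = insert u (insert v A) := by ext; simp
    simp [indInd, this]

end GraphSamples

/-! ### Learners driven by the set of queries answered "no" -/

section Framework

variable {n : ℕ}

/-- A finite set of queries. -/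
abbrev Queries (n : ℕ) : Type := Finset (Finset (Fin n))

open Classical in
/-- The learner that asks all queries in `S` and passes on the set of those answered `no`. -/
noncomputable def askAll (S : Queries n) (next : Queries n → Learner n) : Learner n :=
  .round #S (fun i => (S.equivFin.symm i).1) fun ans =>
    next {Q ∈ S | ∃ i, (S.equivFin.symm i).1 = Q ∧ ans i = false}

/-- The graph of the pairs that no set in `Z` contains. -/
def unseparated (Z : Queries n) : SimpleGraph (Fin n) where
  Adj u v := u ≠ v ∧ ∀ Q ∈ Z, ¬ (u ∈ Q ∧ v ∈ Q)
  symm := ⟨fun _ _ h => ⟨h.1.symm, fun Q hQ hQ' => h.2 Q hQ hQ'.symm⟩⟩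
  loopless := ⟨fun _ h => h.1 rfl⟩

/-- The learner that follows the strategy `s` for `f` rounds, starting with round `r` and with
the set `Z` of queries known to have the answer `no`. -/
noncomputable def runLearner (s : ℕ → Queries n → Queries n) : ℕ → ℕ → Queries n → Learner n
  | 0, _, Z => .output (unseparated Z)
  | f + 1, r, Z => askAll (s r Z) fun no => open Classical in runLearner s f (r + 1) (Z ∪ no)

variable (G : SimpleGraph (Fin n))

open Classical in
/-- The queries known to have the answer `no` before round `r`. -/
noncomputable def knowledge (s : ℕ → Queries n → Queries n) : ℕ → Queries n
  | 0 => ∅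
  | r + 1 => knowledge s r ∪ {Q ∈ s r (knowledge s r) | Indep G Q}

open Classical in
/-- All independent sets of `G`. -/
noncomputable def indSets : Queries n := univ.filter fun Q => Indep G Q

variable {G}

theorem mem_indSets {Q : Finset (Fin n)} : Q ∈ indSets G ↔ Indep G Q := by simp [indSets]

theorem edgeOracle_eq_false {Q : Finset (Fin n)} : edgeOracle G Q = false ↔ Indep G Q := by
  simp [edgeOracle, Indep]

open Classical in
theorem filter_askAll (S : Queries n) :
    {Q ∈ S | ∃ i, (S.equivFin.symm i).1 = Q ∧ edgeOracle G (S.equivFin.symm i).1 = false} =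
      ({Q ∈ S | Indep G Q} : Queries n) := by
  refine filter_congr fun Q hQ => ⟨?_, fun h => ⟨S.equivFin ⟨Q, hQ⟩, by simp, ?_⟩⟩
  · rintro ⟨i, rfl, hi⟩
    exact edgeOracle_eq_false.1 hi
  · simpa using edgeOracle_eq_false.2 h

variable (s : ℕ → Queries n → Queries n)

theorem result_runLearner (f r : ℕ) :
    (runLearner s f r (knowledge G s r)).result G = unseparated (knowledge G s (r + f)) := by
  induction f generalizing r with
  | zero => rfl
  | succ f ih =>
    rw [runLearner, askAll, Learner.result, filter_askAll]
    exact (ih (r + 1)).trans (by congr 2; omega)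

theorem numRounds_runLearner (f r : ℕ) (Z : Queries n) :
    (runLearner s f r Z).numRounds G = f := by
  induction f generalizing r Z with
  | zero => rfl
  | succ f ih => rw [runLearner, askAll, Learner.numRounds, ih]; omega

theorem numQueries_runLearner (f r : ℕ) :
    (runLearner s f r (knowledge G s r)).numQueries G =
      ∑ j ∈ range f, #(s (r + j) (knowledge G s (r + j))) := by
  induction f generalizing r with
  | zero => rfl
  | succ f ih =>
    rw [runLearner, askAll, Learner.numQueries, filter_askAll, sum_range_succ', add_comm]
    congr 1
    refine (ih (r + 1)).trans (sum_congr rfl fun j _ => ?_)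
    rw [add_right_comm, add_assoc]

theorem knowledge_subset_indSets (r : ℕ) : knowledge G s r ⊆ indSets G := by
  induction r with
  | zero => simp [knowledge]
  | succ r ih =>
    rw [knowledge]
    exact union_subset ih fun Q hQ => by
      classical exact mem_indSets.2 (mem_filter.1 hQ).2

theorem knowledge_mono : Monotone (knowledge G s) :=
  monotone_nat_of_le_succ fun r => by rw [knowledge]; exact subset_union_left

variable {s}

theorem mem_knowledge {Q : Finset (Fin n)} {r r' : ℕ} (hr : r < r')
    (hQ : Q ∈ s r (knowledge G s r)) (hI : Indep G Q) : Q ∈ knowledge G s r' := by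
  classical
  refine knowledge_mono s hr ?_
  rw [Nat.succ_eq_add_one, knowledge]
  exact mem_union_right _ (mem_filter.2 ⟨hQ, hI⟩)

end Framework

/-! ### Doubly growing search for the least accepted scale -/

section Search

variable {n : ℕ} (ω : ℕ → ℕ → Finset (Fin n)) (M Λ : ℕ) (δ : ℝ) (b : ℕ → ℕ)

/-- At most the fraction `δ` of the first `M` sets of scale `i`, enlarged by `X`, is missing
in `Z`. -/
def Accepted (Z : Queries n) (X : Finset (Fin n)) (i : ℕ) : Prop :=
  (#{t ∈ range M | ω i t ∪ X ∉ Z} : ℝ) ≤ δ * M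

/-- The least accepted scale. -/
noncomputable def firstScale (Z : Queries n) (X : Finset (Fin n)) : ℕ :=
  sInf {i | i ≤ Λ ∧ Accepted ω M δ Z X i}

open Classical in
/-- The queries of the stage `r` of the search for the least accepted scale. -/
noncomputable def searchQueries (r : ℕ) (Z : Queries n) (X : Finset (Fin n)) : Queries n :=
  if ∃ i < b r, Accepted ω M δ Z X i then ∅
  else (range (b (r + 1)) ×ˢ range M).image fun a => ω a.1 a.2 ∪ X

variable {ω M Λ δ b}

/-- Missing knowledge only makes acceptance harder, so partial knowledge never accepts a scale
wrongly. -/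
theorem Accepted.mono {Z Z' : Queries n} {X : Finset (Fin n)} {i : ℕ} (hZ : Z ⊆ Z')
    (h : Accepted ω M δ Z X i) : Accepted ω M δ Z' X i := by
  refine le_trans ?_ h
  exact_mod_cast card_le_card fun t ht => by
    rw [mem_filter] at ht ⊢
    exact ⟨ht.1, fun h => ht.2 (hZ h)⟩

theorem accepted_of_forall_mem {Z Z' : Queries n} {X : Finset (Fin n)} {i : ℕ}
    (hZ : ∀ t < M, ω i t ∪ X ∈ Z' → ω i t ∪ X ∈ Z)
    (h : Accepted ω M δ Z' X i) : Accepted ω M δ Z X i := by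
  refine le_trans ?_ h
  exact_mod_cast card_le_card fun t ht => by
    rw [mem_filter] at ht ⊢
    exact ⟨ht.1, fun h => ht.2 (hZ t (mem_range.1 ht.1) h)⟩

theorem firstScale_le (Z : Queries n) (X : Finset (Fin n)) : firstScale ω M Λ δ Z X ≤ Λ := by
  rcases Set.eq_empty_or_nonempty {i | i ≤ Λ ∧ Accepted ω M δ Z X i} with h | h
  · simp [firstScale, h]
  · exact (Nat.sInf_mem h).1

theorem accepted_firstScale {Z : Queries n} {X : Finset (Fin n)}
    (h : Accepted ω M δ Z X Λ) : Accepted ω M δ Z X (firstScale ω M Λ δ Z X) :=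
  (Nat.sInf_mem (s := {i | i ≤ Λ ∧ Accepted ω M δ Z X i}) ⟨Λ, le_rfl, h⟩).2

theorem not_accepted_of_lt_firstScale {Z : Queries n} {X : Finset (Fin n)} {i : ℕ}
    (h : i < firstScale ω M Λ δ Z X) : ¬ Accepted ω M δ Z X i := fun h' =>
  Nat.notMem_of_lt_sInf h ⟨h.le.trans (firstScale_le Z X), h'⟩

theorem firstScale_eq {Z Z' : Queries n} {X : Finset (Fin n)} (hZ : Z ⊆ Z')
    (h : Accepted ω M δ Z X (firstScale ω M Λ δ Z' X)) :
    firstScale ω M Λ δ Z X = firstScale ω M Λ δ Z' X := by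
  refine le_antisymm (Nat.sInf_le ⟨firstScale_le Z' X, h⟩) ?_
  have := Nat.sInf_mem (s := {i | i ≤ Λ ∧ Accepted ω M δ Z X i}) ⟨_, firstScale_le Z' X, h⟩
  exact Nat.sInf_le ⟨this.1, this.2.mono hZ⟩

theorem card_searchQueries_le (r : ℕ) (Z : Queries n) (X : Finset (Fin n)) :
    #(searchQueries ω M δ b r Z X) ≤ b (r + 1) * M := by
  unfold searchQueries
  split_ifs
  · simp
  · exact card_image_le.trans (by simp)

variable {k : ℕ} {Z : ℕ → Queries n} {I : Queries n} {X : Finset (Fin n)}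

/-- If an earlier stage accepted some scale, then the true least scale is no larger and was covered
by that stage. Otherwise the current stage asks all sets of the true scale. -/
theorem accepted_of_search (hacc : Accepted ω M δ I X Λ) (hZI : ∀ r, Z r ⊆ I) (hZ : Monotone Z)
    (hs : ∀ r ≤ k, ∀ Q ∈ searchQueries ω M δ b r (Z r) X, Q ∈ I → Q ∈ Z (r + 1))
    (hb : b 0 = 0) {r : ℕ} (hr : r ≤ k + 1) (hi : firstScale ω M Λ δ I X < b r) :
    Accepted ω M δ (Z r) X (firstScale ω M Λ δ I X) := by
  induction r with
  | zero => omega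
  | succ r ih =>
    by_cases h : ∃ i < b r, Accepted ω M δ (Z r) X i
    · obtain ⟨i, hi', hacc'⟩ := h
      have : firstScale ω M Λ δ I X ≤ i := by
        by_contra! hlt
        exact not_accepted_of_lt_firstScale hlt (hacc'.mono (hZI r))
      exact (ih (by omega) (by omega)).mono (hZ r.le_succ)
    · refine accepted_of_forall_mem (fun t ht hI => hs r (by omega) _ ?_ hI)
        (accepted_firstScale hacc)
      rw [searchQueries, if_neg h]
      exact mem_image.2 ⟨(_, t), mem_product.2 ⟨mem_range.2 hi, mem_range.2 ht⟩, rfl⟩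

theorem firstScale_of_search (hacc : Accepted ω M δ I X Λ) (hZI : ∀ r, Z r ⊆ I)
    (hZ : Monotone Z)
    (hs : ∀ r ≤ k, ∀ Q ∈ searchQueries ω M δ b r (Z r) X, Q ∈ I → Q ∈ Z (r + 1))
    (hb : b 0 = 0) (hb' : b (k + 1) = Λ + 1) {r : ℕ} (hr : k + 1 ≤ r) :
    firstScale ω M Λ δ (Z r) X = firstScale ω M Λ δ I X :=
  firstScale_eq (hZI r) <| (accepted_of_search hacc hZI hZ hs hb le_rfl
    (by have := firstScale_le (ω := ω) (M := M) (Λ := Λ) (δ := δ) I X; omega)).mono (hZ hr)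

/-- A stage `r ≥ 1` that still asks something has failed at scale `b r - 1`, so `b (r + 1) ≤ 2 ^ b r
≤ 2 * B`. Stage `0` is the only one charged with `b 1`. -/
theorem card_searchQueries_le_of_search (hacc : Accepted ω M δ I X Λ) (hZI : ∀ r, Z r ⊆ I)
    (hZ : Monotone Z)
    (hs : ∀ r ≤ k, ∀ Q ∈ searchQueries ω M δ b r (Z r) X, Q ∈ I → Q ∈ Z (r + 1))
    (hb : b 0 = 0) (hb2 : ∀ r, 1 ≤ r → r ≤ k → b (r + 1) ≤ 2 ^ b r) {B : ℕ} (hB1 : 1 ≤ B)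
    (hB : ∀ i ≤ Λ, ¬ Accepted ω M δ I X i → 2 ^ i ≤ B) {r : ℕ} (hr : r ≤ k) :
    #(searchQueries ω M δ b r (Z r) X) ≤ (b 1 + 2 * B) * M := by
  by_cases h : ∃ i < b r, Accepted ω M δ (Z r) X i
  · simp [searchQueries, h]
  · refine (card_searchQueries_le r _ X).trans (Nat.mul_le_mul_right M ?_)
    rcases Nat.eq_zero_or_pos r with rfl | h0
    · exact Nat.le_add_right _ _
    · have h1 := hb2 r h0 hr
      rcases Nat.eq_zero_or_pos (b r) with h2 | h2
      · rw [h2] at h1; omega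
      · have h3 : b r ≤ firstScale ω M Λ δ I X := by
          by_contra! hlt
          exact h ⟨_, hlt, accepted_of_search hacc hZI hZ hs hb (by omega) hlt⟩
        have h4 := firstScale_le (ω := ω) (M := M) (Λ := Λ) (δ := δ) I X
        have h5 := hB (b r - 1) (by omega) (not_accepted_of_lt_firstScale (Λ := Λ) (by omega))
        have h6 : 2 ^ b r = 2 * 2 ^ (b r - 1) := by
          rw [← pow_succ']; congr 1; omega
        omega

end Search

/-! ### The learner, its correctness and its worst-case cost -/

section Strategy

variable {n : ℕ} (ω : ℕ → ℕ → Finset (Fin n)) (M Λ : ℕ) (b : ℕ → ℕ) (k : ℕ)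

/-- The scale at which most random sets are known to be independent. -/
noncomputable def baseScale (Z : Queries n) : ℕ := firstScale ω M Λ (1 / 32) Z ∅

open Classical in
/-- The vertices that lie in few random sets of the base scale known to be independent. -/
noncomputable def heavy (Z : Queries n) : Finset (Fin n) :=
  {v | (#{t ∈ range (M * 2 ^ baseScale ω M Λ Z) |
    v ∈ ω (baseScale ω M Λ Z) t ∧ ω (baseScale ω M Λ Z) t ∈ Z} : ℝ) ≤ M / 4}

/-- The scale used to find the neighbours of the heavy vertex `v`. -/
noncomputable def vertexScale (Z : Queries n) (v : Fin n) : ℕ :=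
  max (baseScale ω M Λ Z) (firstScale ω M Λ (1 / 4) Z {v})

open Classical in
/-- The queries that separate the non-adjacent pairs with a vertex that is not heavy. -/
noncomputable def separatingQueries (Z : Queries n) : Queries n :=
  (range (M * 4 ^ baseScale ω M Λ Z)).image (ω (baseScale ω M Λ Z)) ∪
    (heavy ω M Λ Z).biUnion fun v =>
      (range (M * 2 ^ vertexScale ω M Λ Z v)).image fun t => ω (vertexScale ω M Λ Z v) t ∪ {v}

open Classical in
/-- The pairs of distinct vertices that no set in `Z` contains. -/
noncomputable def unseparatedPairs (Z : Queries n) : Queries n :=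
  (univ.filter fun a : Fin n × Fin n => (unseparated Z).Adj a.1 a.2).image fun a => {a.1, a.2}

open Classical in
/-- The strategy: find the base scale, find the heavy vertices, find the scale of every heavy
vertex, separate, and ask the remaining pairs. -/
noncomputable def strategy (r : ℕ) (Z : Queries n) : Queries n :=
  if r ≤ k then searchQueries ω M (1 / 32) b r Z ∅
  else if r = k + 1 then (range (M * 2 ^ baseScale ω M Λ Z)).image (ω (baseScale ω M Λ Z))
  else if r ≤ 2 * k + 2 then
    (heavy ω M Λ Z).biUnion fun v => searchQueries ω M (1 / 4) b (r - (k + 2)) Z {v}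
  else if r = 2 * k + 3 then separatingQueries ω M Λ Z
  else unseparatedPairs Z

/-- The deterministic learner with the random sets `ω`. -/
noncomputable def edgeLearner : Learner n := runLearner (strategy ω M Λ b k) (2 * k + 5) 0 ∅

variable (G : SimpleGraph (Fin n))

/-- What the learner knows before round `r`. -/
noncomputable def known (r : ℕ) : Queries n := knowledge G (strategy ω M Λ b k) r

/-- The two searches take `k + 1` rounds each; the heaviness test, the separation and the final
pairs take one each. -/
theorem numRounds_edgeLearner : (edgeLearner ω M Λ b k).numRounds G = 2 * k + 5 :=
  numRounds_runLearner _ _ _ _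

theorem numQueries_edgeLearner : (edgeLearner ω M Λ b k).numQueries G =
    ∑ r ∈ range (2 * k + 5), #(strategy ω M Λ b k r (known ω M Λ b k G r)) := by
  have := numQueries_runLearner (G := G) (strategy ω M Λ b k) (2 * k + 5) 0
  simp only [zero_add] at this
  exact this

/-- No coins matter here: edges are never separated since known sets are independent, and the last
round asks every pair not yet separated. -/
theorem result_edgeLearner : (edgeLearner ω M Λ b k).result G = G := by
  have h := result_runLearner (G := G) (strategy ω M Λ b k) (2 * k + 5) 0
  rw [zero_add] at h
  refine h.trans ?_
  ext u v
  constructor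
  · rintro ⟨hne, hsep⟩
    by_contra hG
    have hI : Indep G {u, v} := by
      intro x hx y hy hxy
      simp only [mem_insert, mem_singleton] at hx hy
      rcases hx with rfl | rfl <;> rcases hy with rfl | rfl
      · exact G.loopless.irrefl _ hxy
      · exact hG hxy
      · exact hG hxy.symm
      · exact G.loopless.irrefl _ hxy
    refine hsep {u, v} (mem_knowledge (r := 2 * k + 4) (by omega) ?_ hI) (by simp)
    rw [strategy, if_neg (by omega), if_neg (by omega), if_neg (by omega), if_neg (by omega)]
    classical
    refine mem_image.2 ⟨(u, v), mem_filter.2 ⟨mem_univ _, hne, fun Q hQ => hsep Q ?_⟩, rfl⟩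
    exact knowledge_mono _ (by omega) hQ
  · intro hG
    refine ⟨hG.ne, fun Q hQ hQ' => ?_⟩
    exact mem_indSets.1 (knowledge_subset_indSets _ _ hQ) u hQ'.1 v hQ'.2 hG

theorem card_unseparatedPairs_le_sq (Z : Queries n) : #(unseparatedPairs Z) ≤ n ^ 2 := by
  classical
  refine card_image_le.trans ((card_filter_le _ _).trans ?_)
  simp [sq]

theorem vertexScale_le (Z : Queries n) (v : Fin n) : vertexScale ω M Λ Z v ≤ Λ :=
  max_le (firstScale_le _ _) (firstScale_le _ _)

theorem card_strategy_le (hb : ∀ r ≤ k + 1, b r ≤ Λ + 1) (r : ℕ) (Z : Queries n) :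
    #(strategy ω M Λ b k r Z) ≤ (n + 1) * ((Λ + 1) * M * 4 ^ Λ) + n ^ 2 := by
  classical
  have hpos : 1 ≤ 4 ^ Λ := Nat.one_le_pow _ _ (by norm_num)
  have h24 : 2 ^ Λ ≤ 4 ^ Λ := Nat.pow_le_pow_left (by norm_num) _
  set U := (Λ + 1) * M * 4 ^ Λ with hU
  have hsearch : ∀ r ≤ k, ∀ δ X, #(searchQueries ω M δ b r Z X) ≤ U := fun r hr δ X => by
    refine (card_searchQueries_le r Z X).trans
      ((Nat.mul_le_mul_right M (hb (r + 1) (by omega))).trans ?_)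
    exact Nat.le_mul_of_pos_right _ hpos
  have hM4 : M * 4 ^ Λ ≤ U := Nat.mul_le_mul_right _ (Nat.le_mul_of_pos_left M Λ.succ_pos)
  have hscale : ∀ i ≤ Λ, M * 2 ^ i ≤ U := fun i hi =>
    (Nat.mul_le_mul_left M ((Nat.pow_le_pow_right two_pos hi).trans h24)).trans hM4
  have hheavy : ∀ f : Fin n → Queries n, (∀ v, #(f v) ≤ U) →
      #((heavy ω M Λ Z).biUnion f) ≤ n * U := fun f hf => by
    refine (card_biUnion_le_card_mul _ _ U fun v _ => hf v).trans (Nat.mul_le_mul_right U ?_)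
    simpa using card_le_univ (heavy ω M Λ Z)
  have h1 : U ≤ (n + 1) * U + n ^ 2 := by nlinarith
  have h2 : n * U ≤ (n + 1) * U + n ^ 2 := by nlinarith
  unfold strategy
  split_ifs with c1 c2 c3 c4
  · exact (hsearch r c1 _ _).trans h1
  · refine (card_image_le.trans ?_).trans h1
    rw [card_range]
    exact hscale _ (firstScale_le _ _)
  · exact (hheavy _ fun v => hsearch _ (by omega) _ _).trans h2
  · refine (card_union_le _ _).trans ?_
    have e1 : #((range (M * 4 ^ baseScale ω M Λ Z)).image (ω (baseScale ω M Λ Z))) ≤ U := by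
      refine card_image_le.trans ?_
      rw [card_range]
      exact (Nat.mul_le_mul_left M
        (Nat.pow_le_pow_right (by norm_num) (firstScale_le _ _))).trans hM4
    have e2 := hheavy (fun v => (range (M * 2 ^ vertexScale ω M Λ Z v)).image fun t =>
      ω (vertexScale ω M Λ Z v) t ∪ {v}) fun v => by
        refine card_image_le.trans ?_
        rw [card_range]
        exact hscale _ (vertexScale_le ω M Λ Z v)
    nlinarith
  · exact (card_unseparatedPairs_le_sq Z).trans (by omega)

end Strategy

/-! ### Reliable samples and the sizes of scales and of the heavy set -/

section GoodCoins

variable {n : ℕ} (G : SimpleGraph (Fin n)) (ω : ℕ → ℕ → Finset (Fin n)) (M Λ : ℕ)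

/-- The probability that a random set of scale `i` together with `X` is independent. -/
noncomputable def scaleProb (i : ℕ) (X : Finset (Fin n)) : ℝ := indProb G ((2⁻¹ : ℝ) ^ i) X

open Classical in
/-- All tests of the learner have the answer that the probabilities suggest. -/
structure GoodCoins : Prop where
  accepted_empty : ∀ i ≤ Λ, 1 - scaleProb G i ∅ ≤ 1 / 64 → Accepted ω M (1 / 32) (indSets G) ∅ i
  of_accepted_empty : ∀ i ≤ Λ, Accepted ω M (1 / 32) (indSets G) ∅ i →
    1 - scaleProb G i ∅ ≤ 1 / 16
  accepted_vertex : ∀ i ≤ Λ, ∀ v, 1 - scaleProb G i {v} ≤ 1 / 8 →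
    Accepted ω M (1 / 4) (indSets G) {v} i
  of_accepted_vertex : ∀ i ≤ Λ, ∀ v, Accepted ω M (1 / 4) (indSets G) {v} i →
    1 - scaleProb G i {v} ≤ 1 / 2
  lt_count : ∀ i ≤ Λ, ∀ v, 1 / 2 ≤ scaleProb G i {v} →
    (M / 4 : ℝ) < #{t ∈ range (M * 2 ^ i) | v ∈ ω i t ∧ Indep G (ω i t)}
  count_lt : ∀ i ≤ Λ, ∀ v, scaleProb G i {v} ≤ 1 / 8 →
    (#{t ∈ range (M * 2 ^ i) | v ∈ ω i t ∧ Indep G (ω i t)} : ℝ) < M / 4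
  exists_pair : ∀ i ≤ Λ, ∀ u v, u ≠ v → ¬ G.Adj u v → 1 / 8 ≤ scaleProb G i {u} →
    1 / 8 ≤ scaleProb G i {v} → ∃ t < M * 4 ^ i, (u ∈ ω i t ∧ v ∈ ω i t) ∧ Indep G (ω i t)
  exists_single : ∀ i ≤ Λ, ∀ u v, ¬ G.Adj u v → 1 / 8 ≤ scaleProb G i {u} →
    1 / 2 ≤ scaleProb G i {v} → ∃ t < M * 2 ^ i, u ∈ ω i t ∧ Indep G (ω i t ∪ {v})

variable {G ω M Λ}

theorem scaleProb_mono {i j : ℕ} (hij : i ≤ j) (X : Finset (Fin n)) :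
    scaleProb G i X ≤ scaleProb G j X :=
  indProb_antitone (by positivity) (pow_le_pow_of_le_one (by norm_num) (by norm_num) hij)
    (pow_le_one₀ (by norm_num) (by norm_num))

open Classical in
theorem one_sub_scaleProb_empty_le (i : ℕ) :
    (1 - scaleProb G i ∅) * 4 ^ i ≤ ∑ u, (G.degree u : ℝ) := by
  have := one_sub_indProb_empty_le (G := G) (p := (2⁻¹ : ℝ) ^ i) (by positivity)
    (pow_le_one₀ (by norm_num) (by norm_num))
  have e : ((2⁻¹ : ℝ) ^ i) ^ 2 = (4 ^ i)⁻¹ := by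
    rw [← pow_mul, mul_comm, pow_mul, ← inv_pow]; norm_num
  rw [e, ← div_eq_inv_mul, le_div_iff₀ (by positivity)] at this
  exact this

open Classical in
theorem one_sub_scaleProb_singleton_le (i : ℕ) (v : Fin n) :
    (scaleProb G i ∅ - scaleProb G i {v}) * 2 ^ i ≤ G.degree v := by
  have := one_sub_indProb_singleton_le (G := G) (p := (2⁻¹ : ℝ) ^ i) (by positivity)
    (pow_le_one₀ (by norm_num) (by norm_num)) v
  have e : scaleProb G i ∅ - scaleProb G i {v} ≤ (2 ^ i)⁻¹ * G.degree v := by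
    unfold scaleProb; rw [← inv_pow]; linarith
  rw [← div_eq_inv_mul, le_div_iff₀ (by positivity)] at e
  exact e

namespace GoodCoins

variable (hg : GoodCoins G ω M Λ)
include hg

section truth

variable (hΛ : 256 * n ≤ 2 ^ Λ)

open Classical in
omit hg in
theorem sum_degree_le : ∑ u, (G.degree u : ℝ) ≤ n * n := by
  calc ∑ u, (G.degree u : ℝ) ≤ ∑ _u : Fin n, (n : ℝ) := sum_le_sum fun u _ => by
        have := G.degree_lt_card_verts u
        simp only [Fintype.card_fin] at this
        exact_mod_cast this.le
    _ = n * n := by simp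

omit hg in
include hΛ in
theorem one_sub_scaleProb_top_le : 1 - scaleProb G Λ ∅ ≤ 1 / 64 := by
  classical
  have h1 := (one_sub_scaleProb_empty_le (G := G) Λ).trans sum_degree_le
  have h2 : (256 * n : ℝ) ≤ 2 ^ Λ := by exact_mod_cast hΛ
  have h3 : (4 : ℝ) ^ Λ = 2 ^ Λ * 2 ^ Λ := by rw [← mul_pow]; norm_num
  by_contra! h
  have h4 : (0 : ℝ) < 2 ^ Λ := by positivity
  rw [h3] at h1
  have h5 := mul_le_mul h2 h2 (by positivity) h4.le
  have h6 : 0 < (2 : ℝ) ^ Λ * 2 ^ Λ := by positivity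
  nlinarith

include hΛ

theorem accepted_empty_top : Accepted ω M (1 / 32) (indSets G) ∅ Λ :=
  hg.accepted_empty Λ le_rfl (one_sub_scaleProb_top_le hΛ)

theorem accepted_vertex_top (v : Fin n) : Accepted ω M (1 / 4) (indSets G) {v} Λ := by
  classical
  refine hg.accepted_vertex Λ le_rfl v ?_
  have h1 := one_sub_scaleProb_singleton_le (G := G) Λ v
  have h2 : (256 * n : ℝ) ≤ 2 ^ Λ := by exact_mod_cast hΛ
  have h3 : (G.degree v : ℝ) ≤ n := by
    have := G.degree_lt_card_verts v
    simp only [Fintype.card_fin] at this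
    exact_mod_cast this.le
  have h4 := one_sub_scaleProb_top_le (G := G) hΛ
  have h5 : (0 : ℝ) < 2 ^ Λ := by positivity
  by_contra! h
  nlinarith

theorem one_sub_scaleProb_base :
    1 - scaleProb G (baseScale ω M Λ (indSets G)) ∅ ≤ 1 / 16 :=
  hg.of_accepted_empty _ (firstScale_le _ _) (accepted_firstScale (hg.accepted_empty_top hΛ))

omit hΛ in
open Classical in
theorem four_pow_le_of_not_accepted {i : ℕ} (hi : i ≤ Λ)
    (h : ¬ Accepted ω M (1 / 32) (indSets G) ∅ i) : 4 ^ i ≤ 64 * ∑ u, G.degree u := by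
  have h1 := one_sub_scaleProb_empty_le (G := G) i
  have h2 : 1 / 64 < 1 - scaleProb G i ∅ := by
    by_contra! h'
    exact h (hg.accepted_empty i hi h')
  have h3 : (0 : ℝ) < 4 ^ i := by positivity
  have : (4 ^ i : ℝ) ≤ 64 * ∑ u, (G.degree u : ℝ) := by nlinarith
  exact_mod_cast this

omit hΛ in
open Classical in
theorem four_pow_base_le :
    4 ^ baseScale ω M Λ (indSets G) ≤ 256 * (∑ u, G.degree u) + 1 := by
  have hle := firstScale_le (ω := ω) (M := M) (Λ := Λ) (δ := 1 / 32) (indSets G) ∅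
  set i := baseScale ω M Λ (indSets G) with hi
  rcases Nat.eq_zero_or_pos i with h | h
  · rw [h]; omega
  · have h1 := hg.four_pow_le_of_not_accepted (i := i - 1) (by unfold baseScale at hi; omega)
      (not_accepted_of_lt_firstScale (Λ := Λ) (by unfold baseScale at hi; omega))
    have h6 : 4 ^ i = 4 * 4 ^ (i - 1) := by
      rw [← pow_succ']; congr 1; omega
    omega

-- Beyond the base scale the sample alone is dependent with probability at most `1 / 16`, while
-- rejection means more than `1 / 8` with `v`. The neighbours of `v` account for the remaining `1 /
-- 16`, which forces `2 ^ i ≤ 16 * deg v`.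
open Classical in
theorem two_pow_le_of_not_accepted {i : ℕ} (hi : i ≤ Λ) {v : Fin n}
    (h : ¬ Accepted ω M (1 / 4) (indSets G) {v} i) :
    2 ^ i ≤ 2 ^ baseScale ω M Λ (indSets G) + 16 * G.degree v := by
  rcases le_total i (baseScale ω M Λ (indSets G)) with hle | hle
  · exact (Nat.pow_le_pow_right two_pos hle).trans (Nat.le_add_right _ _)
  · refine le_trans ?_ (Nat.le_add_left _ _)
    have h1 := one_sub_scaleProb_singleton_le (G := G) i v
    have h2 : 1 / 8 < 1 - scaleProb G i {v} := by
      by_contra! h'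
      exact h (hg.accepted_vertex i hi v h')
    have h4 := hg.one_sub_scaleProb_base hΛ
    have h5 := scaleProb_mono (G := G) hle ∅
    have h3 : (0 : ℝ) < 2 ^ i := by positivity
    have : (2 ^ i : ℝ) ≤ 16 * G.degree v := by nlinarith
    exact_mod_cast this

omit hΛ in
theorem scaleProb_le_of_mem_heavy {v : Fin n} (hv : v ∈ heavy ω M Λ (indSets G)) :
    scaleProb G (baseScale ω M Λ (indSets G)) {v} ≤ 1 / 2 := by
  classical
  by_contra! h
  have h1 := hg.lt_count _ (firstScale_le _ _) v h.le
  have h2 := (mem_filter.1 hv).2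
  simp only [mem_indSets] at h2
  have := h1.trans_le (le_of_eq_of_le (by congr!) h2)
  exact lt_irrefl _ this

omit hΛ in
theorem le_scaleProb_of_notMem_heavy {v : Fin n} (hv : v ∉ heavy ω M Λ (indSets G)) :
    1 / 8 ≤ scaleProb G (baseScale ω M Λ (indSets G)) {v} := by
  classical
  by_contra! h
  have h1 := hg.count_lt _ (firstScale_le _ _) v h.le
  refine hv (mem_filter.2 ⟨mem_univ _, ?_⟩)
  simp only [mem_indSets]
  exact le_of_eq_of_le (by congr!) h1.le

theorem card_heavy_le : #(heavy ω M Λ (indSets G)) ≤ 2 ^ baseScale ω M Λ (indSets G) := by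
  have := mul_card_le_one (G := G) (p := (2⁻¹ : ℝ) ^ baseScale ω M Λ (indSets G)) (by positivity)
    (pow_le_one₀ (by norm_num) (by norm_num)) (heavy ω M Λ (indSets G))
    (hg.one_sub_scaleProb_base hΛ) fun v hv => hg.scaleProb_le_of_mem_heavy hv
  rw [inv_pow, ← div_eq_inv_mul, div_le_one (by positivity)] at this
  exact_mod_cast this

open Classical in
theorem two_pow_vertexScale_le (v : Fin n) : 2 ^ vertexScale ω M Λ (indSets G) v ≤
    2 * (2 ^ baseScale ω M Λ (indSets G) + 16 * G.degree v) := by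
  have hb1 : 1 ≤ 2 ^ baseScale ω M Λ (indSets G) := Nat.one_le_pow _ _ two_pos
  rcases max_choice (baseScale ω M Λ (indSets G)) (firstScale ω M Λ (1 / 4) (indSets G) {v})
    with h | h <;> rw [vertexScale, h]
  · omega
  · have hle := firstScale_le (ω := ω) (M := M) (Λ := Λ) (δ := 1 / 4) (indSets G) {v}
    set i := firstScale ω M Λ (1 / 4) (indSets G) {v} with hi
    rcases Nat.eq_zero_or_pos i with h | h
    · rw [h, pow_zero]; omega
    · have h1 := hg.two_pow_le_of_not_accepted hΛ (i := i - 1) (v := v) (by omega)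
        (not_accepted_of_lt_firstScale (Λ := Λ) (by omega))
      have h6 : 2 ^ i = 2 * 2 ^ (i - 1) := by
        rw [← pow_succ']; congr 1; omega
      omega

end truth

end GoodCoins

end GoodCoins

/-! ### Cost of a run on good coins -/

section Cost

variable {n : ℕ} {G : SimpleGraph (Fin n)} {ω : ℕ → ℕ → Finset (Fin n)} {M Λ : ℕ} {b : ℕ → ℕ}
  {k : ℕ}

theorem known_subset (r : ℕ) : known ω M Λ b k G r ⊆ indSets G := knowledge_subset_indSets _ r

theorem known_mono : Monotone (known ω M Λ b k G) := knowledge_mono _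

theorem mem_known_of_search_base {r : ℕ} (hr : r ≤ k) {Q : Finset (Fin n)}
    (hQ : Q ∈ searchQueries ω M (1 / 32) b r (known ω M Λ b k G r) ∅) (hI : Q ∈ indSets G) :
    Q ∈ known ω M Λ b k G (r + 1) := by
  refine mem_knowledge (Nat.lt_succ_self r) ?_ (mem_indSets.1 hI)
  rw [strategy, if_pos hr]
  exact hQ

namespace GoodCoins

variable (hg : GoodCoins G ω M Λ) (hΛ : 256 * n ≤ 2 ^ Λ) (hb : b 0 = 0) (hb' : b (k + 1) = Λ + 1)
  (hb2 : ∀ r, 1 ≤ r → r ≤ k → b (r + 1) ≤ 2 ^ b r)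
include hg hΛ hb hb'

/-- This and the next lemmas replace the learner's partial knowledge by `indSets G`, so that
everything it computes becomes a function of the coins and `G` alone. -/
theorem baseScale_known {r : ℕ} (hr : k + 1 ≤ r) :
    baseScale ω M Λ (known ω M Λ b k G r) = baseScale ω M Λ (indSets G) :=
  firstScale_of_search (hg.accepted_empty_top hΛ) known_subset known_mono
    (fun _ hr _ hQ hI => mem_known_of_search_base hr hQ hI) hb hb' hr

theorem mem_known_base {r t : ℕ} (hr : k + 2 ≤ r)
    (ht : t < M * 2 ^ baseScale ω M Λ (indSets G)) :
    ω (baseScale ω M Λ (indSets G)) t ∈ known ω M Λ b k G r ↔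
      ω (baseScale ω M Λ (indSets G)) t ∈ indSets G := by
  refine ⟨fun h => known_subset r h, fun h => mem_knowledge (r := k + 1) (by omega) ?_
    (mem_indSets.1 h)⟩
  rw [strategy, if_neg (by omega), if_pos rfl]
  have := hg.baseScale_known hΛ hb hb' (r := k + 1) le_rfl
  unfold known at this
  rw [this]
  exact mem_image.2 ⟨t, mem_range.2 ht, rfl⟩

theorem heavy_known {r : ℕ} (hr : k + 2 ≤ r) :
    heavy ω M Λ (known ω M Λ b k G r) = heavy ω M Λ (indSets G) := by
  classical
  ext v
  simp only [heavy, mem_filter, mem_univ, true_and]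
  rw [hg.baseScale_known hΛ hb hb' (r := r) (by omega)]
  rw [filter_congr fun t ht => by
    rw [hg.mem_known_base hΛ hb hb' hr (mem_range.1 ht)]]

theorem mem_known_of_search_vertex {v : Fin n} (hv : v ∈ heavy ω M Λ (indSets G)) {r : ℕ}
    (hr : r ≤ k) {Q : Finset (Fin n)}
    (hQ : Q ∈ searchQueries ω M (1 / 4) b r (known ω M Λ b k G (k + 2 + r)) {v})
    (hI : Q ∈ indSets G) : Q ∈ known ω M Λ b k G (k + 2 + (r + 1)) := by
  refine mem_knowledge (Nat.lt_succ_self (k + 2 + r)) ?_ (mem_indSets.1 hI)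
  rw [strategy, if_neg (by omega), if_neg (by omega), if_pos (by omega)]
  have := hg.heavy_known hΛ hb hb' (r := k + 2 + r) (by omega)
  unfold known at this
  rw [this, Nat.add_sub_cancel_left]
  exact mem_biUnion.2 ⟨v, hv, hQ⟩

omit hΛ hb hb' hg in
theorem known_add_mono : Monotone fun r => known ω M Λ b k G (k + 2 + r) :=
  fun _ _ h => known_mono (Nat.add_le_add_left h _)

theorem vertexScale_known {v : Fin n} (hv : v ∈ heavy ω M Λ (indSets G)) {r : ℕ}
    (hr : 2 * k + 3 ≤ r) :
    vertexScale ω M Λ (known ω M Λ b k G r) v = vertexScale ω M Λ (indSets G) v := by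
  have := firstScale_of_search (Z := fun r => known ω M Λ b k G (k + 2 + r))
    (hg.accepted_vertex_top hΛ v) (fun r => known_subset _) known_add_mono
    (fun _ hr _ hQ hI => hg.mem_known_of_search_vertex hΛ hb hb' hv hr hQ hI) hb hb'
    (r := r - (k + 2)) (by omega)
  rw [vertexScale, vertexScale, hg.baseScale_known hΛ hb hb' (by omega), ← this]
  rw [Nat.add_sub_cancel' (by omega)]

theorem separatingQueries_known :
    separatingQueries ω M Λ (known ω M Λ b k G (2 * k + 3)) =
      separatingQueries ω M Λ (indSets G) := by
  rw [separatingQueries, separatingQueries, hg.baseScale_known hΛ hb hb' (by omega),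
    hg.heavy_known hΛ hb hb' (by omega)]
  congr 1
  refine biUnion_congr rfl fun v hv => ?_
  rw [hg.vertexScale_known hΛ hb hb' hv le_rfl]

theorem mem_known_of_separating {r : ℕ} (hr : 2 * k + 4 ≤ r) {Q : Finset (Fin n)}
    (hQ : Q ∈ separatingQueries ω M Λ (indSets G)) (hI : Indep G Q) :
    Q ∈ known ω M Λ b k G r := by
  refine mem_knowledge (r := 2 * k + 3) (by omega) ?_ hI
  rw [strategy, if_neg (by omega), if_neg (by omega), if_neg (by omega), if_pos rfl]
  have := hg.separatingQueries_known hΛ hb hb'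
  unfold known at this
  rwa [this]

/-- The vertex scale is at least the base scale, so the bound `1 / 8` for the non-heavy `u`
persists; it is also at least the accepted scale of `v`, which gives `1 / 2` for `v`. -/
theorem not_unseparated_of_heavy {u v : Fin n} (huv : ¬ G.Adj u v)
    (hu : u ∉ heavy ω M Λ (indSets G)) (hv : v ∈ heavy ω M Λ (indSets G)) :
    ¬ (unseparated (known ω M Λ b k G (2 * k + 4))).Adj u v := by
  classical
  rintro ⟨-, hsep⟩
  have h1 := (hg.le_scaleProb_of_notMem_heavy hu).trans
    (scaleProb_mono (G := G) (le_max_left (baseScale ω M Λ (indSets G))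
      (firstScale ω M Λ (1 / 4) (indSets G) {v})) {u})
  have h2 := (hg.of_accepted_vertex _ (firstScale_le _ _) v
    (accepted_firstScale (hg.accepted_vertex_top hΛ v)))
  have h3 := scaleProb_mono (G := G) (le_max_right (baseScale ω M Λ (indSets G))
      (firstScale ω M Λ (1 / 4) (indSets G) {v})) {v}
  obtain ⟨t, ht, hut, hI⟩ := hg.exists_single (vertexScale ω M Λ (indSets G) v)
    (vertexScale_le _ _ _ _ _) u v huv h1 (by unfold vertexScale; linarith)
  refine hsep _ (hg.mem_known_of_separating hΛ hb hb' le_rfl ?_ hI)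
    ⟨mem_union_left _ hut, mem_union_right _ (mem_singleton_self v)⟩
  exact mem_union_right _ (mem_biUnion.2 ⟨v, hv, mem_image.2 ⟨t, mem_range.2 ht, rfl⟩⟩)

theorem adj_or_mem_heavy {u v : Fin n}
    (h : (unseparated (known ω M Λ b k G (2 * k + 4))).Adj u v) :
    G.Adj u v ∨ u ∈ heavy ω M Λ (indSets G) ∧ v ∈ heavy ω M Λ (indSets G) := by
  classical
  by_contra! hcon
  obtain ⟨huv, hH⟩ := hcon
  by_cases hu : u ∈ heavy ω M Λ (indSets G)
  · exact hg.not_unseparated_of_heavy hΛ hb hb' (fun h => huv h.symm) (hH hu) hu h.symm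
  · by_cases hv : v ∈ heavy ω M Λ (indSets G)
    · exact hg.not_unseparated_of_heavy hΛ hb hb' huv hu hv h
    · obtain ⟨t, ht, hut, hI⟩ := hg.exists_pair (baseScale ω M Λ (indSets G))
        (firstScale_le _ _) u v h.1 huv (hg.le_scaleProb_of_notMem_heavy hu)
        (hg.le_scaleProb_of_notMem_heavy hv)
      exact h.2 _ (hg.mem_known_of_separating hΛ hb hb' le_rfl
        (mem_union_left _ (mem_image.2 ⟨t, mem_range.2 ht, rfl⟩)) hI) hut

open Classical in
theorem card_unseparatedPairs_le : #(unseparatedPairs (known ω M Λ b k G (2 * k + 4))) ≤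
    (∑ u, G.degree u) + 4 ^ baseScale ω M Λ (indSets G) := by
  have hsub : (univ.filter fun a : Fin n × Fin n =>
      (unseparated (known ω M Λ b k G (2 * k + 4))).Adj a.1 a.2) ⊆
      (univ.sigma fun u => G.neighborFinset u).image (fun a => (a.1, a.2)) ∪
        heavy ω M Λ (indSets G) ×ˢ heavy ω M Λ (indSets G) := by
    rintro ⟨u, v⟩ ha
    rcases hg.adj_or_mem_heavy hΛ hb hb' (mem_filter.1 ha).2 with h | h
    · exact mem_union_left _ (mem_image.2 ⟨⟨u, v⟩, by simpa using h, rfl⟩)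
    · exact mem_union_right _ (mem_product.2 h)
  refine card_image_le.trans ((card_le_card hsub).trans ((card_union_le _ _).trans ?_))
  refine add_le_add (card_image_le.trans ?_) ?_
  · rw [card_sigma]
    simp
  · rw [card_product]
    have := hg.card_heavy_le hΛ
    calc _ ≤ 2 ^ baseScale ω M Λ (indSets G) * 2 ^ baseScale ω M Λ (indSets G) :=
          Nat.mul_le_mul this this
      _ = _ := by rw [← mul_pow]; norm_num

omit hb hb' in
open Classical in
theorem sum_heavy_le (x : ℕ) :
    ∑ v ∈ heavy ω M Λ (indSets G), (x + 2 * (2 ^ baseScale ω M Λ (indSets G) + 16 * G.degree v))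
      ≤ 2 ^ baseScale ω M Λ (indSets G) * x + 2 * 4 ^ baseScale ω M Λ (indSets G) +
        32 * ∑ u, G.degree u := by
  have h1 := hg.card_heavy_le hΛ
  have h2 : ∑ v ∈ heavy ω M Λ (indSets G), G.degree v ≤ ∑ u, G.degree u :=
    sum_le_sum_of_subset (subset_univ _)
  have h4 : 4 ^ baseScale ω M Λ (indSets G) =
      2 ^ baseScale ω M Λ (indSets G) * 2 ^ baseScale ω M Λ (indSets G) := by
    rw [← mul_pow]; norm_num
  rw [sum_add_distrib, ← mul_sum, sum_add_distrib, ← mul_sum, sum_const, sum_const, smul_eq_mul,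
    smul_eq_mul, h4]
  nlinarith [Nat.mul_le_mul_right x h1,
    Nat.mul_le_mul_right (2 ^ baseScale ω M Λ (indSets G)) h1]

include hb2

open Classical in
/-- On good coins no round asks many queries. -/
theorem card_strategy_known_le (hM : 1 ≤ M) {m : ℕ} (hm : 1 ≤ m)
    (hG : ∑ u, G.degree u ≤ 2 * m) {r : ℕ} (hr : r < 2 * k + 5) :
    #(strategy ω M Λ b k r (known ω M Λ b k G r)) ≤
      M * (2000 * m + 2 ^ baseScale ω M Λ (indSets G) * b 1) := by
  have h4 := hg.four_pow_base_le
  have hb1 : 1 ≤ 2 ^ baseScale ω M Λ (indSets G) := Nat.one_le_pow _ _ two_pos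
  have h24 : 2 ^ baseScale ω M Λ (indSets G) ≤ 4 ^ baseScale ω M Λ (indSets G) :=
    Nat.pow_le_pow_left (by norm_num) _
  have hbb := Nat.le_mul_of_pos_left (b 1) hb1
  unfold strategy
  split_ifs with c1 c2 c3 c4
  -- A rejected scale has `2 ^ i ≤ 4 ^ i ≤ 64 * ∑ deg`; the `+ 1` ensures `1 ≤ B` for an edgeless
  -- graph.
  · have := card_searchQueries_le_of_search (B := 64 * (∑ u, G.degree u) + 1)
      (hg.accepted_empty_top hΛ) known_subset known_mono
      (fun _ hr _ hQ hI => mem_known_of_search_base (Λ := Λ) hr hQ hI) hb hb2 (by omega)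
      (fun i hi h => ((Nat.pow_le_pow_left (by norm_num) i).trans
        (hg.four_pow_le_of_not_accepted hi h)).trans (Nat.le_succ _)) c1
    refine this.trans ?_
    rw [mul_comm]
    exact Nat.mul_le_mul_left M (by omega)
  · rw [hg.baseScale_known hΛ hb hb' (by omega)]
    refine card_image_le.trans ?_
    rw [card_range]
    exact Nat.mul_le_mul_left M (by omega)
  · rw [hg.heavy_known hΛ hb hb' (by omega)]
    refine card_biUnion_le.trans ?_
    have hv : ∀ v ∈ heavy ω M Λ (indSets G),
        #(searchQueries ω M (1 / 4) b (r - (k + 2)) (known ω M Λ b k G r) {v}) ≤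
          (b 1 + 2 * (2 ^ baseScale ω M Λ (indSets G) + 16 * G.degree v)) * M := by
      intro v hv
      have := card_searchQueries_le_of_search (Z := fun r => known ω M Λ b k G (k + 2 + r))
        (hg.accepted_vertex_top hΛ v) (fun r => known_subset _) known_add_mono
        (fun _ hr _ hQ hI => hg.mem_known_of_search_vertex hΛ hb hb' hv hr hQ hI) hb hb2
        (B := 2 ^ baseScale ω M Λ (indSets G) + 16 * G.degree v) (by omega)
        (fun i hi h => hg.two_pow_le_of_not_accepted hΛ hi h) (r := r - (k + 2)) (by omega)
      rwa [Nat.add_sub_cancel' (by omega)] at this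
    refine (sum_le_sum hv).trans ?_
    rw [← sum_mul, mul_comm]
    -- At most `2 ^ base` heavy vertices each pay the first stage `b 1`; this is the source of the
    -- `√m` term.
    refine Nat.mul_le_mul_left M ((hg.sum_heavy_le hΛ (b 1)).trans ?_)
    omega
  · rw [c4, hg.separatingQueries_known hΛ hb hb']
    refine (card_union_le _ _).trans ?_
    have e1 : #((range (M * 4 ^ baseScale ω M Λ (indSets G))).image
        (ω (baseScale ω M Λ (indSets G)))) ≤ M * 4 ^ baseScale ω M Λ (indSets G) :=
      card_image_le.trans (card_range _).le
    have e2 : #((heavy ω M Λ (indSets G)).biUnion fun v =>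
        (range (M * 2 ^ vertexScale ω M Λ (indSets G) v)).image fun t =>
          ω (vertexScale ω M Λ (indSets G) v) t ∪ {v}) ≤
        M * (2 * 4 ^ baseScale ω M Λ (indSets G) + 32 * ∑ u, G.degree u) := by
      refine card_biUnion_le.trans ?_
      refine (sum_le_sum fun v hv => (card_image_le.trans (card_range _).le).trans
        (Nat.mul_le_mul_left M (hg.two_pow_vertexScale_le hΛ v))).trans ?_
      rw [← mul_sum]
      refine Nat.mul_le_mul_left M ?_
      have := hg.sum_heavy_le hΛ 0
      simpa using this
    refine (add_le_add e1 e2).trans ?_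
    rw [← mul_add]
    exact Nat.mul_le_mul_left M (by omega)
  · obtain rfl : r = 2 * k + 4 := by omega
    refine (hg.card_unseparatedPairs_le hΛ hb hb').trans ?_
    refine le_trans ?_ (Nat.le_mul_of_pos_left _ hM)
    omega

theorem numQueries_le (hM : 1 ≤ M) {m : ℕ} (hm : 1 ≤ m) (hG : G.edgeSet.ncard ≤ m) :
    ((edgeLearner ω M Λ b k).numQueries G : ℝ) ≤
      (2 * k + 5) * (M * (2000 * m + 23 * Real.sqrt m * b 1)) := by
  classical
  have hdeg : ∑ u, G.degree u ≤ 2 * m := by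
    rw [G.sum_degrees_eq_twice_card_edges, ← Set.ncard_coe_finset, SimpleGraph.coe_edgeFinset]
    omega
  have h1 : (edgeLearner ω M Λ b k).numQueries G ≤
      (2 * k + 5) * (M * (2000 * m + 2 ^ baseScale ω M Λ (indSets G) * b 1)) := by
    rw [numQueries_edgeLearner]
    refine (sum_le_card_nsmul _ _ _ fun r hr =>
      hg.card_strategy_known_le hΛ hb hb' hb2 hM hm hdeg (mem_range.1 hr)).trans ?_
    simp
  -- With degree sum at most `2 * m` one gets `4 ^ base ≤ 513 * m`, and `529 = 23 ^ 2` is the next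
  -- square.
  have h2 : (2 : ℝ) ^ baseScale ω M Λ (indSets G) ≤ 23 * Real.sqrt m := by
    have h4 := hg.four_pow_base_le
    have h5 : 4 ^ baseScale ω M Λ (indSets G) ≤ 529 * m := by omega
    have h6 : ((2 : ℝ) ^ baseScale ω M Λ (indSets G)) ^ 2 ≤ 529 * m := by
      rw [← pow_mul, mul_comm, pow_mul]
      norm_num
      exact_mod_cast h5
    have h7 : (529 : ℝ) * m = (23 * Real.sqrt m) ^ 2 := by
      rw [mul_pow, Real.sq_sqrt (Nat.cast_nonneg m)]; norm_num
    rw [h7] at h6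
    exact le_of_sq_le_sq h6 (by positivity)
  have h3 : ((edgeLearner ω M Λ b k).numQueries G : ℝ) ≤
      (2 * k + 5) * (M * (2000 * m + 2 ^ baseScale ω M Λ (indSets G) * b 1)) := by
    exact_mod_cast h1
  refine h3.trans ?_
  gcongr

end GoodCoins

end Cost

/-! ### The random samples are good with high probability -/

section Coins

variable {n : ℕ} {Λ N : ℕ}

/-- The table of random sets as a function on pairs of natural numbers. -/
def coinTable (x : Fin (Λ + 1) × Fin N → Finset (Fin n)) (i t : ℕ) : Finset (Fin n) :=
  if h : i < Λ + 1 ∧ t < N then x (⟨i, h.1⟩, ⟨t, h.2⟩) else ∅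

/-- The weights of the random sets: those of scale `i` have density `2⁻ⁱ`. -/
noncomputable def coinWt (n Λ N : ℕ) (a : Fin (Λ + 1) × Fin N) : Finset (Fin n) → ℝ :=
  setWt ((2⁻¹ : ℝ) ^ (a.1 : ℕ))

/-- The indices of the first `K` random sets of scale `i`. -/
def coinIdx (Λ N i K : ℕ) : Finset (Fin (Λ + 1) × Fin N) :=
  {a | (a.1 : ℕ) = i ∧ (a.2 : ℕ) < K}

theorem scale_nonneg (i : ℕ) : (0 : ℝ) ≤ (2⁻¹ : ℝ) ^ i := by positivity

theorem scale_le_one (i : ℕ) : (2⁻¹ : ℝ) ^ i ≤ 1 := pow_le_one₀ (by norm_num) (by norm_num)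

theorem coinWt_nonneg (a : Fin (Λ + 1) × Fin N) (A : Finset (Fin n)) : 0 ≤ coinWt n Λ N a A :=
  setWt_nonneg (scale_nonneg _) (scale_le_one _) A

theorem sum_coinWt (a : Fin (Λ + 1) × Fin N) : ∑ A, coinWt n Λ N a A = 1 := sum_setWt

theorem coinWt_of_mem {i K : ℕ} {a : Fin (Λ + 1) × Fin N} (ha : a ∈ coinIdx Λ N i K) :
    coinWt n Λ N a = setWt ((2⁻¹ : ℝ) ^ i) := by
  rw [coinWt, (mem_filter.1 ha).2.1]

theorem card_filter_coinTable {i K : ℕ} (hi : i ≤ Λ) (hK : K ≤ N) (P : Finset (Fin n) → Prop)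
    [DecidablePred P] (x : Fin (Λ + 1) × Fin N → Finset (Fin n)) :
    #{t ∈ range K | P (coinTable x i t)} = #{a ∈ coinIdx Λ N i K | P (x a)} := by
  have e : ∀ t (ht : t < K), coinTable x i t =
      x (⟨i, Nat.lt_succ_of_le hi⟩, ⟨t, ht.trans_le hK⟩) := fun t ht =>
    dif_pos ⟨Nat.lt_succ_of_le hi, ht.trans_le hK⟩
  refine card_bij (fun t ht => (⟨i, Nat.lt_succ_of_le hi⟩,
    ⟨t, (mem_range.1 (mem_filter.1 ht).1).trans_le hK⟩)) ?_ ?_ ?_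
  · intro t ht
    have ht' := mem_filter.1 ht
    rw [e t (mem_range.1 ht'.1)] at ht'
    exact mem_filter.2 ⟨mem_filter.2 ⟨mem_univ _, rfl, mem_range.1 ht'.1⟩, ht'.2⟩
  · intro t _ t' _ h
    simpa using h
  · rintro ⟨⟨j, hj⟩, ⟨t, ht⟩⟩ ha
    obtain ⟨ha1, ha2⟩ := mem_filter.1 ha
    obtain ⟨h1, h2⟩ := (mem_filter.1 ha1).2
    simp only at h1 h2
    subst h1
    exact ⟨t, mem_filter.2 ⟨mem_range.2 h2, by rwa [e t h2]⟩, rfl⟩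

theorem card_coinIdx {i K : ℕ} (hi : i ≤ Λ) (hK : K ≤ N) : #(coinIdx Λ N i K) = K := by
  -- Counting with a predicate that is always true turns the transfer lemma into the cardinality.
  have := card_filter_coinTable (n := 0) hi hK (fun _ => True) fun _ => ∅
  simpa using this.symm

open Classical in
theorem prob_count_ge {i K : ℕ} (hi : i ≤ Λ) (hK : K ≤ N) {P : Finset (Fin n) → Prop} {δ y : ℝ}
    (hδ : 0 ≤ δ) (hy : δ * K = y) (hq : wtProb (setWt ((2⁻¹ : ℝ) ^ i)) P ≤ δ / 2) :
    piProb (coinWt n Λ N) (fun x => y ≤ #{t ∈ range K | P (coinTable x i t)}) ≤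
      Real.exp (-(y / 8)) := by
  have := chernoff_ge (J := coinIdx Λ N i K) coinWt_nonneg sum_coinWt hδ
    (P := P) fun a ha => by rwa [coinWt_of_mem ha]
  rw [card_coinIdx hi hK, hy] at this
  exact (piProb_mono coinWt_nonneg fun x hx => by
    rwa [card_filter_coinTable hi hK P x] at hx).trans this

open Classical in
theorem prob_count_le {i K : ℕ} (hi : i ≤ Λ) (hK : K ≤ N) {P : Finset (Fin n) → Prop} {δ y : ℝ}
    (hδ : 0 ≤ δ) (hy : δ * K = y) (hq : 2 * δ ≤ wtProb (setWt ((2⁻¹ : ℝ) ^ i)) P) :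
    piProb (coinWt n Λ N) (fun x => #{t ∈ range K | P (coinTable x i t)} ≤ y) ≤
      Real.exp (-(y / 8)) := by
  have := chernoff_le (J := coinIdx Λ N i K) coinWt_nonneg sum_coinWt hδ
    (P := P) fun a ha => by rwa [coinWt_of_mem ha]
  rw [card_coinIdx hi hK, hy] at this
  exact (piProb_mono coinWt_nonneg fun x hx => by
    rwa [card_filter_coinTable hi hK P x] at hx).trans this

theorem prob_forall_not {i K : ℕ} (hi : i ≤ Λ) (hK : K ≤ N) {P : Finset (Fin n) → Prop} {η y : ℝ}
    (hy : η * K = y) (hq : η ≤ wtProb (setWt ((2⁻¹ : ℝ) ^ i)) P) :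
    piProb (coinWt n Λ N) (fun x => ¬ ∃ t < K, P (coinTable x i t)) ≤ Real.exp (-y) := by
  have := piProb_forall_not_le (J := coinIdx Λ N i K) coinWt_nonneg sum_coinWt
    (P := P) (η := η) fun a ha => by rwa [coinWt_of_mem ha]
  rw [card_coinIdx hi hK, hy] at this
  refine (piProb_mono coinWt_nonneg fun x hx a ha hP => hx ⟨a.2, ?_⟩).trans this
  obtain ⟨h1, h2⟩ := (mem_filter.1 ha).2
  refine ⟨h2, ?_⟩
  rw [coinTable, dif_pos ⟨by omega, a.2.2⟩]
  convert hP
  exact h1.symm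

theorem piProb_and_le {ι α : Type*} [Fintype ι] [DecidableEq ι] [Fintype α] {w : ι → α → ℝ}
    (hw : ∀ i a, 0 ≤ w i a) {c : Prop} {S : (ι → α) → Prop} {ε : ℝ} (hε : 0 ≤ ε)
    (h : c → piProb w S ≤ ε) : piProb w (fun x => c ∧ S x) ≤ ε := by
  by_cases hc : c
  · exact (piProb_mono hw fun x hx => hx.2).trans (h hc)
  · simp only [hc, false_and]
    rwa [piProb_false]

variable {G : SimpleGraph (Fin n)} {M : ℕ}

theorem pow_inv_mul (M i : ℕ) (c : ℝ) : (2⁻¹ : ℝ) ^ i * c * (M * 2 ^ i : ℕ) = M * c := by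
  have : ((2 : ℝ)⁻¹) ^ i * 2 ^ i = 1 := by rw [← mul_pow]; norm_num
  push_cast
  linear_combination (M * c) * this

theorem sq_pow_inv_mul (M i : ℕ) (c : ℝ) :
    ((2⁻¹ : ℝ) ^ i) ^ 2 * c * (M * 4 ^ i : ℕ) = M * c := by
  have : (((2 : ℝ)⁻¹) ^ i) ^ 2 * 4 ^ i = 1 := by
    rw [← pow_mul, mul_comm i, pow_mul, ← mul_pow]; norm_num
  push_cast
  linear_combination (M * c) * this

/-- Chernoff with the true rate at most half the threshold `δ`; the exponent `δ * M / 8` is at least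
`M / 256` since `δ ≥ 1 / 32`. -/
theorem prob_not_accepted (hMN : M ≤ N) {i : ℕ} (hi : i ≤ Λ) (X : Finset (Fin n)) {δ : ℝ}
    (hδ : 1 / 32 ≤ δ) (hq : 1 - scaleProb G i X ≤ δ / 2) :
    piProb (coinWt n Λ N) (fun x => ¬ Accepted (coinTable x) M δ (indSets G) X i) ≤
      Real.exp (-(M / 256)) := by
  classical
  have := prob_count_ge (n := n) (K := M) (P := fun A => ¬ Indep G (A ∪ X)) hi hMN
    (by linarith : 0 ≤ δ) rfl (by rwa [wtProb_not_indep])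
  refine ((piProb_mono coinWt_nonneg fun x hx => ?_).trans this).trans (Real.exp_le_exp.2 ?_)
  · rw [Accepted, not_le] at hx
    simp only [mem_indSets] at hx
    exact hx.le.trans (le_of_eq (by congr!))
  · have : (0 : ℝ) ≤ M := Nat.cast_nonneg M
    nlinarith

theorem prob_accepted (hMN : M ≤ N) {i : ℕ} (hi : i ≤ Λ) (X : Finset (Fin n)) {δ : ℝ}
    (hδ : 1 / 32 ≤ δ) (hq : 2 * δ ≤ 1 - scaleProb G i X) :
    piProb (coinWt n Λ N) (fun x => Accepted (coinTable x) M δ (indSets G) X i) ≤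
      Real.exp (-(M / 256)) := by
  classical
  have := prob_count_le (n := n) (K := M) (P := fun A => ¬ Indep G (A ∪ X)) hi hMN
    (by linarith : 0 ≤ δ) rfl (by rwa [wtProb_not_indep])
  refine ((piProb_mono coinWt_nonneg fun x hx => ?_).trans this).trans (Real.exp_le_exp.2 ?_)
  · rw [Accepted] at hx
    simp only [mem_indSets] at hx
    exact (le_of_eq (by congr!)).trans hx
  · have : (0 : ℝ) ≤ M := Nat.cast_nonneg M
    nlinarith

-- Among `M * 2 ^ i` samples the expected count is `M * scaleProb G i {v} ≥ M / 2`, twice the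
-- threshold.
open Classical in
theorem prob_count_mem_le {i : ℕ} (hi : i ≤ Λ) (hK : M * 2 ^ i ≤ N) {v : Fin n}
    (h : 1 / 2 ≤ scaleProb G i {v}) :
    piProb (coinWt n Λ N) (fun x => (#{t ∈ range (M * 2 ^ i) |
      v ∈ coinTable x i t ∧ Indep G (coinTable x i t)} : ℝ) ≤ M / 4) ≤
      Real.exp (-(M / 256)) := by
  have hp := scale_nonneg i
  have := prob_count_le (n := n) (P := fun A => v ∈ A ∧ Indep G A)
    (δ := (2⁻¹ : ℝ) ^ i * (1 / 4)) (y := M / 4) hi hK (by positivity)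
    (by rw [pow_inv_mul]; ring) (by
      rw [wtProb_mem_indep]
      unfold scaleProb at h
      nlinarith)
  have hM0 : (0 : ℝ) ≤ M := Nat.cast_nonneg M
  exact (piProb_mono coinWt_nonneg fun x hx => (le_of_eq (by congr!)).trans hx).trans
    (this.trans (Real.exp_le_exp.2 (by linarith)))

open Classical in
theorem prob_le_count_mem {i : ℕ} (hi : i ≤ Λ) (hK : M * 2 ^ i ≤ N) {v : Fin n}
    (h : scaleProb G i {v} ≤ 1 / 8) :
    piProb (coinWt n Λ N) (fun x => (M / 4 : ℝ) ≤ #{t ∈ range (M * 2 ^ i) |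
      v ∈ coinTable x i t ∧ Indep G (coinTable x i t)}) ≤
      Real.exp (-(M / 256)) := by
  have hp := scale_nonneg i
  have := prob_count_ge (n := n) (P := fun A => v ∈ A ∧ Indep G A)
    (δ := (2⁻¹ : ℝ) ^ i * (1 / 4)) (y := M / 4) hi hK (by positivity)
    (by rw [pow_inv_mul]; ring) (by
      rw [wtProb_mem_indep]
      unfold scaleProb at h
      nlinarith)
  have hM0 : (0 : ℝ) ≤ M := Nat.cast_nonneg M
  exact (piProb_mono coinWt_nonneg fun x hx => hx.trans (le_of_eq (by congr!))).trans
    (this.trans (Real.exp_le_exp.2 (by linarith)))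

theorem prob_not_exists_pair {i : ℕ} (hi : i ≤ Λ) (hK : M * 4 ^ i ≤ N) {u v : Fin n}
    (hne : u ≠ v) (huv : ¬ G.Adj u v) (hu : 1 / 8 ≤ scaleProb G i {u})
    (hv : 1 / 8 ≤ scaleProb G i {v}) :
    piProb (coinWt n Λ N) (fun x => ¬ ∃ t < M * 4 ^ i,
      (u ∈ coinTable x i t ∧ v ∈ coinTable x i t) ∧ Indep G (coinTable x i t)) ≤
      Real.exp (-(M / 256)) := by
  have hM0 : (0 : ℝ) ≤ M := Nat.cast_nonneg M
  have := mul_le_mul hu hv (by norm_num) ((by norm_num : (0 : ℝ) ≤ 1 / 8).trans hu)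
  refine (prob_forall_not (P := fun A => (u ∈ A ∧ v ∈ A) ∧ Indep G A)
    (η := ((2⁻¹ : ℝ) ^ i) ^ 2 * (1 / 64)) (y := M * (1 / 64)) hi hK
    (sq_pow_inv_mul M i _) ?_).trans (Real.exp_le_exp.2 (by linarith))
  refine le_trans ?_ (wtProb_mem_mem_indep (scale_nonneg i) (scale_le_one i) hne huv)
  refine mul_le_mul_of_nonneg_left ?_ (sq_nonneg _)
  unfold scaleProb at this
  linarith

theorem prob_not_exists_single {i : ℕ} (hi : i ≤ Λ) (hK : M * 2 ^ i ≤ N) {u v : Fin n}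
    (huv : ¬ G.Adj u v) (hu : 1 / 8 ≤ scaleProb G i {u}) (hv : 1 / 2 ≤ scaleProb G i {v}) :
    piProb (coinWt n Λ N) (fun x => ¬ ∃ t < M * 2 ^ i,
      u ∈ coinTable x i t ∧ Indep G (coinTable x i t ∪ {v})) ≤ Real.exp (-(M / 256)) := by
  have hM0 : (0 : ℝ) ≤ M := Nat.cast_nonneg M
  have := mul_le_mul hu hv (by norm_num) ((by norm_num : (0 : ℝ) ≤ 1 / 8).trans hu)
  refine (prob_forall_not (P := fun A => u ∈ A ∧ Indep G (A ∪ {v}))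
    (η := (2⁻¹ : ℝ) ^ i * (1 / 16)) (y := M * (1 / 16)) hi hK
    (pow_inv_mul M i _) ?_).trans (Real.exp_le_exp.2 (by linarith))
  refine le_trans ?_ (wtProb_mem_indep_insert (scale_nonneg i) (scale_le_one i) huv)
  refine mul_le_mul_of_nonneg_left ?_ (scale_nonneg i)
  unfold scaleProb at this
  linarith

/-- The coins are good with high probability. -/
theorem prob_not_goodCoins_le (hn : 1 ≤ n) (hN : N = M * 4 ^ Λ) :
    piProb (coinWt n Λ N) (fun x => ¬ GoodCoins G (coinTable x) M Λ) ≤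
      (Λ + 1) * n ^ 2 * (8 * Real.exp (-(M / 256))) := by
  classical
  set ε := Real.exp (-(M / 256 : ℝ)) with hε
  have hε0 : 0 ≤ ε := (Real.exp_pos _).le
  have hM0 : (0 : ℝ) ≤ M := Nat.cast_nonneg M
  have h4 : ∀ i ≤ Λ, M * 4 ^ i ≤ N := fun i hi => hN ▸
    Nat.mul_le_mul_left M (Nat.pow_le_pow_right (by norm_num) hi)
  have h2 : ∀ i ≤ Λ, M * 2 ^ i ≤ N := fun i hi =>
    (Nat.mul_le_mul_left M (Nat.pow_le_pow_left (by norm_num) i)).trans (h4 i hi)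
  have h1 : M ≤ N := by simpa using h4 0 (Nat.zero_le _)
  have hw : ∀ (a : Fin (Λ + 1) × Fin N) (A : Finset (Fin n)), 0 ≤ coinWt n Λ N a A :=
    coinWt_nonneg
  -- Each bad event couples a deterministic condition on `G` with the failure of one test, so it has
  -- probability at most `ε` whether or not the condition holds. All are indexed by a scale and two
  -- vertices, for one union bound.
  let B1 : ℕ → (Fin (Λ + 1) × Fin N → Finset (Fin n)) → Prop := fun i x =>
    1 - scaleProb G i ∅ ≤ 1 / 64 ∧ ¬ Accepted (coinTable x) M (1 / 32) (indSets G) ∅ i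
  let B2 : ℕ → (Fin (Λ + 1) × Fin N → Finset (Fin n)) → Prop := fun i x =>
    1 / 16 < 1 - scaleProb G i ∅ ∧ Accepted (coinTable x) M (1 / 32) (indSets G) ∅ i
  let B3 : ℕ → Fin n → (Fin (Λ + 1) × Fin N → Finset (Fin n)) → Prop := fun i v x =>
    1 - scaleProb G i {v} ≤ 1 / 8 ∧ ¬ Accepted (coinTable x) M (1 / 4) (indSets G) {v} i
  let B4 : ℕ → Fin n → (Fin (Λ + 1) × Fin N → Finset (Fin n)) → Prop := fun i v x =>
    1 / 2 < 1 - scaleProb G i {v} ∧ Accepted (coinTable x) M (1 / 4) (indSets G) {v} i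
  let cnt : ℕ → Fin n → (Fin (Λ + 1) × Fin N → Finset (Fin n)) → ℝ := fun i v x =>
    #{t ∈ range (M * 2 ^ i) | v ∈ coinTable x i t ∧ Indep G (coinTable x i t)}
  let B5 : ℕ → Fin n → (Fin (Λ + 1) × Fin N → Finset (Fin n)) → Prop := fun i v x =>
    1 / 2 ≤ scaleProb G i {v} ∧ cnt i v x ≤ M / 4
  let B6 : ℕ → Fin n → (Fin (Λ + 1) × Fin N → Finset (Fin n)) → Prop := fun i v x =>
    scaleProb G i {v} ≤ 1 / 8 ∧ M / 4 ≤ cnt i v x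
  let B7 : ℕ → Fin n → Fin n → (Fin (Λ + 1) × Fin N → Finset (Fin n)) → Prop := fun i u v x =>
    (u ≠ v ∧ ¬ G.Adj u v ∧ 1 / 8 ≤ scaleProb G i {u} ∧ 1 / 8 ≤ scaleProb G i {v}) ∧
      ¬ ∃ t < M * 4 ^ i, (u ∈ coinTable x i t ∧ v ∈ coinTable x i t) ∧ Indep G (coinTable x i t)
  let B8 : ℕ → Fin n → Fin n → (Fin (Λ + 1) × Fin N → Finset (Fin n)) → Prop := fun i u v x =>
    (¬ G.Adj u v ∧ 1 / 8 ≤ scaleProb G i {u} ∧ 1 / 2 ≤ scaleProb G i {v}) ∧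
      ¬ ∃ t < M * 2 ^ i, u ∈ coinTable x i t ∧ Indep G (coinTable x i t ∪ {v})
  let B : ℕ × Fin n × Fin n → (Fin (Λ + 1) × Fin N → Finset (Fin n)) → Prop := fun a x =>
    B1 a.1 x ∨ B2 a.1 x ∨ B3 a.1 a.2.2 x ∨ B4 a.1 a.2.2 x ∨ B5 a.1 a.2.2 x ∨ B6 a.1 a.2.2 x ∨
      B7 a.1 a.2.1 a.2.2 x ∨ B8 a.1 a.2.1 a.2.2 x
  have hbad : ∀ x, ¬ GoodCoins G (coinTable x) M Λ →
      ∃ a ∈ range (Λ + 1) ×ˢ (univ : Finset (Fin n × Fin n)), B a x := by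
    intro x hx
    by_contra! hB
    have hB' : ∀ i ≤ Λ, ∀ u v, ¬ B (i, u, v) x := fun i hi u v =>
      hB (i, u, v) (mem_product.2 ⟨mem_range.2 (Nat.lt_succ_of_le hi), mem_univ _⟩)
    simp only [B, not_or] at hB'
    -- The events about `∅` ignore the vertices of their index, but some vertex is needed to form
    -- one.
    let v0 : Fin n := ⟨0, hn⟩
    refine hx ⟨fun i hi h => ?_, fun i hi h => ?_, fun i hi v h => ?_, fun i hi v h => ?_,
      fun i hi v h => ?_, fun i hi v h => ?_, fun i hi u v hne huv h h' => ?_,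
      fun i hi u v huv h h' => ?_⟩
    · by_contra hc; exact (hB' i hi v0 v0).1 ⟨h, hc⟩
    · by_contra hc; exact (hB' i hi v0 v0).2.1 ⟨not_le.1 hc, h⟩
    · by_contra hc; exact (hB' i hi v v).2.2.1 ⟨h, hc⟩
    · by_contra hc; exact (hB' i hi v v).2.2.2.1 ⟨not_le.1 hc, h⟩
    · by_contra hc
      exact (hB' i hi v v).2.2.2.2.1 ⟨h, (le_of_eq (by simp only [cnt])).trans (not_lt.1 hc)⟩
    · by_contra hc
      exact (hB' i hi v v).2.2.2.2.2.1 ⟨h, (not_lt.1 hc).trans (le_of_eq (by simp only [cnt]))⟩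
    · by_contra hc; exact (hB' i hi u v).2.2.2.2.2.2.1 ⟨⟨hne, huv, h, h'⟩, hc⟩
    · by_contra hc; exact (hB' i hi u v).2.2.2.2.2.2.2 ⟨⟨huv, h, h'⟩, hc⟩
  have hprob : ∀ a ∈ range (Λ + 1) ×ˢ (univ : Finset (Fin n × Fin n)),
      piProb (coinWt n Λ N) (B a) ≤ 8 * ε := by
    rintro ⟨i, u, v⟩ ha
    have hi : i ≤ Λ := Nat.le_of_lt_succ (mem_range.1 (mem_product.1 ha).1)
    have p1 : piProb (coinWt n Λ N) (B1 i) ≤ ε := piProb_and_le hw hε0 fun h =>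
      prob_not_accepted h1 hi ∅ le_rfl (by linarith)
    have p2 : piProb (coinWt n Λ N) (B2 i) ≤ ε := piProb_and_le hw hε0 fun h =>
      prob_accepted h1 hi ∅ le_rfl (by linarith)
    have p3 : piProb (coinWt n Λ N) (B3 i v) ≤ ε := piProb_and_le hw hε0 fun h =>
      prob_not_accepted h1 hi {v} (by norm_num) (by linarith)
    have p4 : piProb (coinWt n Λ N) (B4 i v) ≤ ε := piProb_and_le hw hε0 fun h =>
      prob_accepted h1 hi {v} (by norm_num) (by linarith)
    have p5 : piProb (coinWt n Λ N) (B5 i v) ≤ ε := piProb_and_le hw hε0 fun h =>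
      prob_count_mem_le hi (h2 i hi) h
    have p6 : piProb (coinWt n Λ N) (B6 i v) ≤ ε := piProb_and_le hw hε0 fun h =>
      prob_le_count_mem hi (h2 i hi) h
    have p7 : piProb (coinWt n Λ N) (B7 i u v) ≤ ε := piProb_and_le hw hε0 fun h =>
      prob_not_exists_pair hi (h4 i hi) h.1 h.2.1 h.2.2.1 h.2.2.2
    have p8 : piProb (coinWt n Λ N) (B8 i u v) ≤ ε := piProb_and_le hw hε0 fun h =>
      prob_not_exists_single hi (h2 i hi) h.1 h.2.1 h.2.2
    calc piProb (coinWt n Λ N) (B (i, u, v)) ≤ ε + (ε + (ε + (ε + (ε + (ε + (ε + ε)))))) :=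
          (piProb_or_le hw _ _).trans <| add_le_add p1 <|
          (piProb_or_le hw _ _).trans <| add_le_add p2 <|
          (piProb_or_le hw _ _).trans <| add_le_add p3 <|
          (piProb_or_le hw _ _).trans <| add_le_add p4 <|
          (piProb_or_le hw _ _).trans <| add_le_add p5 <|
          (piProb_or_le hw _ _).trans <| add_le_add p6 <|
          (piProb_or_le hw _ _).trans <| add_le_add p7 p8
      _ = 8 * ε := by ring
  refine (piProb_mono hw hbad).trans ((piProb_exists_le hw _ _).trans ?_)
  refine (sum_le_card_nsmul _ _ _ hprob).trans (le_of_eq ?_)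
  rw [card_product, card_range, card_univ, Fintype.card_prod, Fintype.card_fin, nsmul_eq_mul]
  push_cast
  ring

end Coins

/-! ### From weighted sums to `PMF` -/

section Distribution

variable {n : ℕ}

/-- The distribution of independent coordinates with weights `w`. -/
noncomputable def piPMF {ι α : Type*} [Fintype ι] [DecidableEq ι] [Fintype α] (w : ι → α → ℝ)
    (hw : ∀ i a, 0 ≤ w i a) (hw1 : ∀ i, ∑ a, w i a = 1) : PMF (ι → α) :=
  PMF.ofFintype (fun x => ENNReal.ofReal (∏ i, w i (x i))) <| by
    rw [← ENNReal.ofReal_sum_of_nonneg fun x _ => prod_nonneg fun i _ => hw i (x i),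
      ← ENNReal.ofReal_one, ← piExp_one hw1]
    simp [piExp]

variable {ι α : Type*} [Fintype ι] [DecidableEq ι] [Fintype α] {w : ι → α → ℝ}
  (hw : ∀ i a, 0 ≤ w i a) (hw1 : ∀ i, ∑ a, w i a = 1) (f : (ι → α) → Learner n)
  (G : SimpleGraph (Fin n))

theorem expectedQueries_map : RandomizedLearner.expectedQueries ((piPMF w hw hw1).map f) G =
    ENNReal.ofReal (piExp w fun x => ((f x).numQueries G : ℝ)) := by
  classical
  rw [RandomizedLearner.expectedQueries]
  simp only [PMF.map_apply]
  simp_rw [← ENNReal.tsum_mul_right]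
  rw [ENNReal.tsum_comm]
  have : ∀ x, ∑' a : Learner n, (if a = f x then (piPMF w hw hw1) x else 0) *
      ((a.numQueries G : ℕ) : ℝ≥0∞) = ENNReal.ofReal ((∏ i, w i (x i)) * (f x).numQueries G) := by
    intro x
    rw [tsum_eq_single (f x) fun a ha => by simp [ha], if_pos rfl,
      ENNReal.ofReal_mul (prod_nonneg fun i _ => hw i (x i)), ENNReal.ofReal_natCast]
    rfl
  rw [piExp, ENNReal.ofReal_sum_of_nonneg fun x _ => mul_nonneg
    (prod_nonneg fun i _ => hw i (x i)) (Nat.cast_nonneg _), tsum_fintype]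
  exact sum_congr rfl fun x _ => by convert this x

theorem probMoreQueries_map (y : ℝ) :
    RandomizedLearner.probMoreQueries ((piPMF w hw hw1).map f) G y =
      ENNReal.ofReal (piProb w fun x => y < ((f x).numQueries G : ℝ)) := by
  classical
  rw [RandomizedLearner.probMoreQueries, PMF.toOuterMeasure_map_apply,
    PMF.toOuterMeasure_apply_fintype, piProb, piExp, ENNReal.ofReal_sum_of_nonneg fun x _ =>
      mul_nonneg (prod_nonneg fun i _ => hw i (x i)) (by split_ifs <;> norm_num)]
  refine sum_congr rfl fun x _ => ?_
  by_cases h : y < ((f x).numQueries G : ℝ)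
  · rw [Set.indicator_of_mem (by simpa using h), if_pos h, mul_one]
    rfl
  · rw [Set.indicator_of_notMem (by simpa using h), if_neg h, mul_zero, ENNReal.ofReal_zero]

end Distribution

/-! ### Stage bounds and iterated logarithms -/

section IteratedLogarithm

/-- The number of scales that the stages of the search consider. -/
def stageBound (k Λ r : ℕ) : ℕ := if r = 0 then 0 else (Nat.clog 2)^[k + 1 - r] (Λ + 1)

theorem stageBound_last (k Λ : ℕ) : stageBound k Λ (k + 1) = Λ + 1 := by
  simp [stageBound]

/-- The bounds are built backwards from `Λ + 1`, each being the `clog` of the next, so they grow at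
most exponentially and the first is a `k`-fold logarithm of `Λ + 1`. -/
theorem stageBound_succ_le (k Λ r : ℕ) (hr : 1 ≤ r) (hrk : r ≤ k) :
    stageBound k Λ (r + 1) ≤ 2 ^ stageBound k Λ r := by
  have e : k + 1 - r = (k + 1 - (r + 1)) + 1 := by omega
  rw [stageBound, stageBound, if_neg (by omega), if_neg (by omega), e,
    Function.iterate_succ_apply']
  exact Nat.le_pow_clog (by norm_num) _

theorem clog_two_le_self (x : ℕ) : Nat.clog 2 x ≤ x :=
  Nat.clog_le_of_le_pow Nat.lt_two_pow_self.le

theorem stageBound_le (k Λ r : ℕ) : stageBound k Λ r ≤ Λ + 1 := by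
  unfold stageBound
  split_ifs
  · omega
  · generalize k + 1 - r = j
    induction j with
    | zero => rfl
    | succ j ih =>
      rw [Function.iterate_succ_apply']
      exact (clog_two_le_self _).trans ih

theorem clog_le_logb_add_one {x : ℕ} (hx : 1 ≤ x) : (Nat.clog 2 x : ℝ) ≤ Real.logb 2 x + 1 := by
  have h : (0 : ℝ) ≤ Real.logb 2 x := Real.logb_nonneg (by norm_num) (by exact_mod_cast hx)
  have := Real.natCeil_logb_natCast 2 x
  rw [← this]
  exact_mod_cast (Nat.ceil_lt_add_one h).le

theorem iterLog_nonneg (k n : ℕ) : 0 ≤ iterLog k n := by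
  cases k with
  | zero => exact Nat.cast_nonneg n
  | succ k =>
    rw [iterLog, Function.iterate_succ_apply']
    exact le_max_left _ _

theorem clog_le_of_le {x : ℕ} {c y : ℝ} (hc : 1 ≤ c) (hy : 0 ≤ y) (hx : x ≤ c * (1 + y)) :
    (Nat.clog 2 x : ℝ) ≤ (2 + Real.logb 2 c) * (1 + max 0 (Real.logb 2 y)) := by
  have hlc : 0 ≤ Real.logb 2 c := Real.logb_nonneg (by norm_num) hc
  have hm : 0 ≤ max 0 (Real.logb 2 y) := le_max_left _ _
  rcases Nat.eq_zero_or_pos x with rfl | h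
  · simp only [Nat.clog_zero_right, Nat.cast_zero]; positivity
  · have h1 := clog_le_logb_add_one h
    have h2 : Real.logb 2 x ≤ Real.logb 2 (c * (1 + y)) :=
      Real.logb_le_logb_of_le (by norm_num) (by exact_mod_cast h) hx
    rw [Real.logb_mul (by linarith) (by linarith)] at h2
    have h3 : Real.logb 2 (1 + y) ≤ 1 + max 0 (Real.logb 2 y) := by
      rcases le_total y 1 with h | h
      · have : Real.logb 2 (1 + y) ≤ Real.logb 2 2 :=
          Real.logb_le_logb_of_le (by norm_num) (by linarith) (by linarith)
        rw [Real.logb_self_eq_one (by norm_num)] at this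
        linarith
      · have : Real.logb 2 (1 + y) ≤ Real.logb 2 (2 * y) :=
          Real.logb_le_logb_of_le (by norm_num) (by linarith) (by linarith)
        rw [Real.logb_mul (by norm_num) (by linarith), Real.logb_self_eq_one (by norm_num)] at this
        linarith [le_max_right 0 (Real.logb 2 y)]
    nlinarith

/-- `Nat.clog 2 n + 9` is `Λ + 1` for the final choice of `Λ`. The base case gives away a whole
logarithm through `Nat.clog 2 n ≤ n`; each further logarithm changes only the constant. -/
theorem exists_clog_iterate_le (k : ℕ) : ∃ c : ℝ, 1 ≤ c ∧ ∀ n : ℕ,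
    ((Nat.clog 2)^[k] (Nat.clog 2 n + 9) : ℝ) ≤ c * (1 + iterLog k n) := by
  induction k with
  | zero =>
    refine ⟨9, by norm_num, fun n => ?_⟩
    have : (Nat.clog 2 n : ℝ) ≤ n := by exact_mod_cast clog_two_le_self n
    simp only [Function.iterate_zero, id_eq, iterLog, Nat.cast_add, Nat.cast_ofNat]
    have : (0 : ℝ) ≤ n := Nat.cast_nonneg n
    linarith
  | succ k ih =>
    obtain ⟨c, hc, h⟩ := ih
    refine ⟨2 + Real.logb 2 c, ?_, fun n => ?_⟩
    · linarith [Real.logb_nonneg (by norm_num : (1 : ℝ) < 2) hc]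
    · rw [Function.iterate_succ_apply', iterLog, Function.iterate_succ_apply']
      exact clog_le_of_le hc (iterLog_nonneg k n) (h n)

end IteratedLogarithm

/-! ### Numerical estimates -/

section Numerics

theorem eight_mul_pow_le {L : ℕ} (hL : 1 ≤ L) : 8 * ((L + 9) * (2 ^ L) ^ 2) ≤ 2 ^ (10 * L) := by
  have h1 : L < 2 ^ L := Nat.lt_two_pow_self
  have h2 : 2 ≤ 2 ^ L := by simpa using Nat.pow_le_pow_right two_pos hL
  have e : 2 ^ (10 * L) = (2 ^ L) ^ 10 := by rw [mul_comm, pow_mul]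
  rw [e]
  set y := 2 ^ L
  have h3 : L + 9 ≤ 2 ^ 4 * y := by omega
  calc 8 * ((L + 9) * y ^ 2) ≤ 2 ^ 3 * (2 ^ 4 * y * y ^ 2) := by gcongr; norm_num
    _ = 2 ^ 7 * y ^ 3 := by ring
    _ ≤ y ^ 7 * y ^ 3 := by gcongr
    _ = y ^ 10 := by ring

theorem worst_case_le {n L c : ℕ} (hL : 1 ≤ L) (hn : n ≤ 2 ^ L) :
    (n + 1) * ((L + 8 + 1) * (c * L) * 4 ^ (L + 8)) + n ^ 2 ≤ (c + 1) * 2 ^ (26 * L) := by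
  have h1 : L < 2 ^ L := Nat.lt_two_pow_self
  have h2 : 2 ≤ 2 ^ L := by simpa using Nat.pow_le_pow_right two_pos hL
  have e : 2 ^ (26 * L) = (2 ^ L) ^ 26 := by rw [mul_comm, pow_mul]
  have e4 : 4 ^ (L + 8) = (2 ^ L) ^ 2 * 2 ^ 16 := by
    rw [pow_add, ← pow_mul, mul_comm L 2, pow_mul]
    norm_num
  rw [e, e4]
  set y := 2 ^ L
  have h3 : L + 8 + 1 ≤ 2 ^ 4 * y := by omega
  have h4 : n + 1 ≤ 2 * y := by omega
  have h5 : y ^ 2 ≤ y ^ 26 := Nat.pow_le_pow_right (by omega) (by norm_num)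
  have h6 : n ^ 2 ≤ y ^ 2 := Nat.pow_le_pow_left hn 2
  have h7 : (n + 1) * ((L + 8 + 1) * (c * L) * (y ^ 2 * 2 ^ 16)) ≤ c * y ^ 26 := by
    calc (n + 1) * ((L + 8 + 1) * (c * L) * (y ^ 2 * 2 ^ 16))
        ≤ (2 * y) * ((2 ^ 4 * y) * (c * y) * (y ^ 2 * 2 ^ 16)) := by gcongr
      _ = c * (2 ^ 21 * y ^ 5) := by ring
      _ ≤ c * (y ^ 21 * y ^ 5) := by gcongr
      _ = c * y ^ 26 := by ring
  calc _ ≤ c * y ^ 26 + y ^ 26 := add_le_add h7 (h6.trans h5)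
    _ = _ := by ring

theorem exp_neg_le_half_pow (j : ℕ) : Real.exp (-j) ≤ (2 ^ j : ℝ)⁻¹ := by
  rw [Real.exp_neg]
  refine inv_anti₀ (by positivity) ?_
  have h : (2 : ℝ) ≤ Real.exp 1 := by linarith [Real.add_one_le_exp (1 : ℝ)]
  calc (2 : ℝ) ^ j ≤ Real.exp 1 ^ j := pow_le_pow_left₀ (by norm_num) h j
    _ = Real.exp j := by rw [← Real.exp_nat_mul, mul_one]

theorem cost_le {c L m s b y l c0 : ℝ} (hc : 0 ≤ c) (hL : L ≤ 2 * l) (hl : 0 ≤ l) (hs : 0 ≤ s)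
    (hsm : s ≤ m) (hb : b ≤ c0 * (1 + y)) (hb0 : 0 ≤ b) (hy : 0 ≤ y) (hc0 : 0 ≤ c0) :
    c * L * (2000 * m + 23 * s * b) ≤ 2 * c * (2000 + 23 * c0) * (m * l + s * y * l) := by
  have hm : 0 ≤ m := hs.trans hsm
  have h1 : 23 * s * b ≤ 23 * s * (c0 * (1 + y)) := by gcongr
  have h2 : c0 * s ≤ c0 * m := by gcongr
  have h3 : 0 ≤ s * y := mul_nonneg hs hy
  calc c * L * (2000 * m + 23 * s * b)
      ≤ c * (2 * l) * ((2000 + 23 * c0) * (m + s * y)) := by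
        refine mul_le_mul (by gcongr) ?_ (by positivity) (by positivity)
        linarith
    _ = 2 * c * (2000 + 23 * c0) * (m * l + s * y * l) := by ring

end Numerics

/-! ### Choice of parameters and the final bounds -/

section Main

theorem piExp_le_add {ι α : Type*} [Fintype ι] [DecidableEq ι] [Fintype α] {w : ι → α → ℝ}
    (hw : ∀ i a, 0 ≤ w i a) (hw1 : ∀ i, ∑ a, w i a = 1) {f : (ι → α) → ℝ} {S : (ι → α) → Prop}
    {B U : ℝ} (hB0 : 0 ≤ B) (hB : ∀ x, ¬ S x → f x ≤ B) (hU : ∀ x, f x ≤ U) :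
    piExp w f ≤ B + U * piProb w S := by
  classical
  calc piExp w f ≤ piExp w (fun x => B * 1 + U * if S x then 1 else 0) := by
        refine piExp_mono hw fun x => ?_
        by_cases h : S x
        · simp only [h, if_true]; linarith [hU x]
        · simp only [h, if_false]; linarith [hB x h]
    _ = B + U * piProb w S := by
        rw [piExp_add, piExp_const_mul, piExp_const_mul, piExp_one hw1, mul_one, piProb]

theorem numQueries_worst_case {n L c k : ℕ} (hL : 1 ≤ L) (hn : n ≤ 2 ^ L)
    (ω : ℕ → ℕ → Finset (Fin n)) (G : SimpleGraph (Fin n)) :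
    ((edgeLearner ω (c * L) (L + 8) (stageBound k (L + 8)) k).numQueries G : ℝ) ≤
      (2 * k + 5) * ((c + 1) * 2 ^ (26 * L)) := by
  have : (edgeLearner ω (c * L) (L + 8) (stageBound k (L + 8)) k).numQueries G ≤
      (2 * k + 5) * ((c + 1) * 2 ^ (26 * L)) := by
    rw [numQueries_edgeLearner]
    refine (sum_le_card_nsmul _ _ _ fun r _ => (card_strategy_le _ _ _ _ _
      (fun r _ => stageBound_le k _ r) r _).trans (worst_case_le hL hn)).trans ?_
    simp
  exact_mod_cast this

/-- Of the exponent `(36 + d) * L`, the part `10 * L` pays for the union bound, `26 * L` will cancel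
the worst-case cost, and `d * L` gives `n ^ (-d)`. -/
theorem prob_bad_le {n L d N : ℕ} (hL : 1 ≤ L) (hn1 : 1 ≤ n) (hn : n ≤ 2 ^ L)
    (hN : N = 256 * (36 + d) * L * 4 ^ (L + 8)) (G : SimpleGraph (Fin n)) :
    piProb (coinWt n (L + 8) N)
      (fun x => ¬ GoodCoins G (coinTable x) (256 * (36 + d) * L) (L + 8)) ≤
      (2 ^ (26 * L) : ℝ)⁻¹ * ((2 ^ L) ^ d)⁻¹ := by
  refine (prob_not_goodCoins_le hn1 hN).trans ?_
  have h1 := exp_neg_le_half_pow ((36 + d) * L)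
  have e : -(((256 * (36 + d) * L : ℕ) : ℝ) / 256) = -(((36 + d) * L : ℕ) : ℝ) := by
    push_cast; ring
  rw [e]
  have h2 : (8 : ℝ) * ((L + 9) * (2 ^ L) ^ 2) ≤ 2 ^ (10 * L) := by
    exact_mod_cast eight_mul_pow_le hL
  have h3 : (n : ℝ) ≤ 2 ^ L := by exact_mod_cast hn
  calc (((L + 8 : ℕ) : ℝ) + 1) * (n : ℝ) ^ 2 * (8 * Real.exp (-(((36 + d) * L : ℕ) : ℝ)))
      ≤ (((L + 8 : ℕ) : ℝ) + 1) * (2 ^ L) ^ 2 * (8 * (2 ^ ((36 + d) * L) : ℝ)⁻¹) := by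
        gcongr
    _ = (8 * ((L + 9) * (2 ^ L) ^ 2)) * (2 ^ ((36 + d) * L) : ℝ)⁻¹ := by push_cast; ring
    _ ≤ 2 ^ (10 * L) * (2 ^ ((36 + d) * L) : ℝ)⁻¹ := by gcongr
    _ = (2 ^ (26 * L) : ℝ)⁻¹ * ((2 ^ L) ^ d)⁻¹ := by
        have : (36 + d) * L = 10 * L + 26 * L + L * d := by ring
        rw [this, pow_add, pow_add, ← pow_mul 2 L d]
        field_simp

theorem exists_learner (k d : ℕ) : ∃ C : ℝ, ∀ n : ℕ, 2 ≤ n → ∃ A : RandomizedLearner n,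
    A.IsLasVegas ∧ A.RoundsAtMost (2 * k + 5) ∧
    ∀ m : ℕ, 1 ≤ m → ∀ G : SimpleGraph (Fin n), G.edgeSet.ncard ≤ m →
      A.expectedQueries G ≤ ENNReal.ofReal (C * queryBound k n m) ∧
      A.probMoreQueries G (C * queryBound k n m) ≤ ENNReal.ofReal (1 / (n : ℝ) ^ d) := by
  obtain ⟨c0, hc0, hc⟩ := exists_clog_iterate_le k
  set c : ℕ := 256 * (36 + d) with hcdef
  set C1 : ℝ := (2 * k + 5) * (2 * c * (2000 + 23 * c0)) with hC1
  set C2 : ℝ := (2 * k + 5) * (c + 1) with hC2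
  have hC1' : 0 ≤ C1 := by positivity
  have hC2' : 0 ≤ C2 := by positivity
  refine ⟨C1 + C2, fun n hn => ?_⟩
  set L := Nat.clog 2 n with hLdef
  have hL : 1 ≤ L := Nat.clog_pos (by norm_num) hn
  have hnL : n ≤ 2 ^ L := Nat.le_pow_clog (by norm_num) n
  -- The largest number of samples ever needed at one scale: `M * 4 ^ Λ` with `M = c * L` and `Λ = L
  -- + 8`. The summand `8` yields `256 * n ≤ 2 ^ Λ`, so that the top scale is accepted.
  set N := c * L * 4 ^ (L + 8) with hN
  let learner : (Fin (L + 8 + 1) × Fin N → Finset (Fin n)) → Learner n := fun x =>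
    edgeLearner (coinTable x) (c * L) (L + 8) (stageBound k (L + 8)) k
  refine ⟨(piPMF (coinWt n (L + 8) N) coinWt_nonneg sum_coinWt).map learner, ?_, ?_, ?_⟩
  · intro G a ha
    obtain ⟨x, -, rfl⟩ := (PMF.mem_support_map_iff _ _ _).1 ha
    exact result_edgeLearner _ _ _ _ _ G
  · intro G a ha
    obtain ⟨x, -, rfl⟩ := (PMF.mem_support_map_iff _ _ _).1 ha
    exact (numRounds_edgeLearner _ _ _ _ _ G).le
  · intro m hm G hG
    have hlog : 1 ≤ Real.logb 2 n := by
      rw [← Real.logb_self_eq_one (b := 2) (by norm_num)]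
      exact Real.logb_le_logb_of_le (by norm_num) (by norm_num) (by exact_mod_cast hn)
    have hm' : (1 : ℝ) ≤ m := by exact_mod_cast hm
    have hs1 : Real.sqrt m ≤ m := by
      exact Real.sqrt_le_iff.2 ⟨by linarith, by nlinarith⟩
    have hs0 := Real.sqrt_nonneg (m : ℝ)
    have hit := iterLog_nonneg k n
    have hqb : 1 ≤ queryBound k n m := by
      unfold queryBound
      have : 0 ≤ Real.sqrt m * iterLog k n * Real.logb 2 n := by positivity
      nlinarith
    have hLlog : (L : ℝ) ≤ 2 * Real.logb 2 n := by
      linarith [clog_le_logb_add_one (by omega : 1 ≤ n)]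
    have hgood : ∀ x, ¬ ¬ GoodCoins G (coinTable x) (c * L) (L + 8) →
        ((learner x).numQueries G : ℝ) ≤ C1 * queryBound k n m := by
      intro x hx
      have hcL : 1 ≤ c * L := Nat.mul_pos (by omega : 0 < c) hL
      have hΛ : 256 * n ≤ 2 ^ (L + 8) := by rw [pow_add]; omega
      have h := (not_not.1 hx).numQueries_le (b := stageBound k (L + 8)) hΛ (by simp [stageBound]) (stageBound_last k _)
        (stageBound_succ_le k _) hcL hm hG
      refine h.trans ?_
      have hb1 : (stageBound k (L + 8) 1 : ℝ) ≤ c0 * (1 + iterLog k n) := by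
        simpa [stageBound] using hc n
      rw [hC1, mul_assoc (2 * (k : ℝ) + 5) (2 * c * (2000 + 23 * c0)) (queryBound k n m)]
      refine mul_le_mul_of_nonneg_left ?_ (by positivity)
      rw [Nat.cast_mul]
      exact cost_le (Nat.cast_nonneg c) hLlog (by linarith) hs0 hs1 hb1 (Nat.cast_nonneg _) hit
        (by linarith)
    have hbad := prob_bad_le (d := d) (N := N) hL (by omega) hnL (by rw [hN, hcdef]) G
    rw [← hcdef] at hbad
    constructor
    · rw [expectedQueries_map]
      refine ENNReal.ofReal_le_ofReal ?_
      refine (piExp_le_add coinWt_nonneg sum_coinWt (by positivity) hgood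
        fun x => numQueries_worst_case hL hnL _ G).trans ?_
      -- Bad coins contribute at most the constant `C2` to the expectation, which is absorbed
      -- because `queryBound` is at least `1` for `n ≥ 2`.
      have h1 : (2 * (k : ℝ) + 5) * (((c : ℕ) + 1) * 2 ^ (26 * L)) *
          piProb (coinWt n (L + 8) N) (fun x => ¬ GoodCoins G (coinTable x) (c * L) (L + 8)) ≤
          C2 := by
        refine (mul_le_mul_of_nonneg_left hbad (by positivity)).trans ?_
        have h2 : ((2 ^ L : ℝ) ^ d)⁻¹ ≤ 1 :=
          inv_le_one_of_one_le₀ (one_le_pow₀ (one_le_pow₀ (by norm_num)))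
        calc _ = C2 * ((2 ^ L : ℝ) ^ d)⁻¹ := by rw [hC2]; field_simp
          _ ≤ C2 := mul_le_of_le_one_right hC2' h2
      nlinarith
    · rw [probMoreQueries_map]
      refine ENNReal.ofReal_le_ofReal ?_
      refine ((piProb_mono coinWt_nonneg fun x hx hg => ?_).trans hbad).trans ?_
      · have := hgood x (not_not.2 hg)
        have : C1 * queryBound k n m ≤ (C1 + C2) * queryBound k n m := by gcongr; linarith
        linarith
      · have h1 : ((2 : ℝ) ^ (26 * L))⁻¹ ≤ 1 := inv_le_one_of_one_le₀ (one_le_pow₀ (by norm_num))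
        have h2 : (n : ℝ) ^ d ≤ (2 ^ L) ^ d := by
          gcongr; exact_mod_cast hnL
        have h3 : (0 : ℝ) < (n : ℝ) ^ d := by
          have : (0 : ℝ) < n := by exact_mod_cast (by omega : 0 < n)
          positivity
        rw [one_div]
        exact (mul_le_of_le_one_left (by positivity) h1).trans (inv_anti₀ h3 h2)

end Main

end EdgeLearning

theorem mainTheorem2 (k : ℕ) :
    ∃ R : ℕ, ∀ d : ℕ, ∃ C : ℝ, ∀ n : ℕ, ∃ A : RandomizedLearner n,
      A.IsLasVegas ∧ A.RoundsAtMost R ∧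
      ∀ m : ℕ, 1 ≤ m → ∀ G : SimpleGraph (Fin n), G.edgeSet.ncard ≤ m →
        A.expectedQueries G ≤ ENNReal.ofReal (C * queryBound k n m) ∧
        A.probMoreQueries G (C * queryBound k n m) ≤ ENNReal.ofReal (1 / (n : ℝ) ^ d) := by
  refine ⟨2 * k + 5, fun d => ?_⟩
  obtain ⟨C, hC⟩ := EdgeLearning.exists_learner k d
  refine ⟨C, fun n => ?_⟩
  rcases Nat.lt_or_ge n 2 with hn | hn
  -- For `n ≤ 1` the bound is `0`, so nothing may be asked; the empty graph is the only one.
  · have : Subsingleton (Fin n) := ⟨fun a b => Fin.ext (by omega)⟩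
    have hq : ∀ m, queryBound k n m = 0 := fun m => by
      have : Real.logb 2 (n : ℝ) = 0 := by interval_cases n <;> simp
      simp [queryBound, this]
    refine ⟨PMF.pure (.output ⊥), fun G a ha => ?_, fun G a ha => ?_, fun m _ G _ => ⟨?_, ?_⟩⟩
    · rw [PMF.support_pure, Set.mem_singleton_iff] at ha
      subst ha
      ext u v
      simp only [Learner.result]
      rw [Subsingleton.elim u v]
      simp
    · rw [PMF.support_pure, Set.mem_singleton_iff] at ha
      subst ha
      simp [Learner.numRounds]
    · rw [RandomizedLearner.expectedQueries, ENNReal.tsum_eq_zero.2]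
      · exact zero_le
      · intro a
        by_cases h : a = .output ⊥
        · simp [h, Learner.numQueries]
        · simp [PMF.pure_apply, h]
    · rw [RandomizedLearner.probMoreQueries, hq, mul_zero, PMF.toOuterMeasure_pure_apply,
        if_neg (by simp [Learner.numQueries])]
      exact zero_le
  · exact hC n hn
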